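/- Let $S_1(n)=\sum_{k=1}^n X_{1,k}$ and $S_2(n)=\sum_{k=1}^n X_{2,k}$ be two independent copies of a random walk on $\mathbb Z^2$ started at $0$, where all the steps $X_{i,k}$ are independent with a common law. Assume that the step law is symmetric and has finite second moment, that $\mathbb Z^2$ is the smallest group which supports the walk, and that the walk is strongly aperiodic: for every $z\in\mathbb Z^2$ the set $z+\{x: P(X_{1,1}=x)>0\}$ generates the group $\mathbb Z^2$. Let $(b_n)_{n\ge1}$ be a sequence of positive real numbers with $b_n\to\infty$ and $b_n=o(n)$. Let $f\in\mathcal S(\mathbb R^2)$ be nonnegative and symmetric ($f(-x)=f(x)$) with $\int_{\mathbb R^2} f\,dx=1$, such that $\widehat f(p)=\int_{\mathbb R^2} e^{-ip\cdot x}f(x)\,dx$ vanishes outside $(-\pi,\pi)^2$. For $r>0$ and $x \in\mathbb R^2$ put $f_r(x)=r^{-2}f(r^{-1}x)$ and $(f_r\circledast f_r)(x)=\sum_{z\in\mathbb Z^2}f_r(z)f_r(x-z)$. For $y\in\mathbb Z^2$, $n\ge1$ and $\epsilon>0$ define $$I_n(y)=\#\{(n_1,n_2)\in\{1,\dots,n\}^2:\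 S_1(n_1)=S_2(n_2)+y\},$$ $$I_{n,\epsilon}(y)=\sum_{n_1,n_2=1}^n \big(f_{r}\circledast f_{r}\big)\big(S_2(n_2)-S_1(n_1)+y\big),\qquad r=\epsilon\,(n/b_n)^{1/2}.$$ Then for every $\lambda>0$, $$\limsup_{\epsilon\to0^+}\ \limsup_{n\to\infty}\ \sup_{y\in\mathbb Z^2}\ \frac1{b_n}\log \mathbb E\exp\left\{\lambda\left|\frac{I_n(y)-I_{n,\epsilon}(y)}{n/b_n}\right|^{1/2}\right\}=0.$$ -/

import Mathlib

open MeasureTheory ProbabilityTheory Filter Topology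
open scoped ENNReal SchwartzMap

noncomputable section

namespace PlanarWalk

/-- The integer lattice `ℤ²`. -/
abbrev Lattice : Type := Fin 2 → ℤ

/-- The Euclidean plane `ℝ²`. -/
abbrev Plane : Type := EuclideanSpace ℝ (Fin 2)

/-- The inclusion `ℤ² ⊆ ℝ²`. -/
def toPlane (x : Lattice) : Plane := WithLp.toLp 2 (fun i => (x i : ℝ))

/-- The set of possible steps of a walk whose steps have law `ν`. -/
def stepSupport (ν : Measure Lattice) : Set Lattice := {x | ν {x} ≠ 0}

/-- The step law of a symmetric, strongly aperiodic random walk on `ℤ²` with finite second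
moments, for which `ℤ²` is the smallest group that supports the walk. Strong aperiodicity:
for every `z`, the translate by `z` of the set of possible steps still generates `ℤ²`. -/
structure IsAdmissibleStep (ν : Measure Lattice) : Prop where
  symmetric : ∀ x, ν {-x} = ν {x}
  secondMoment : Integrable (fun x => ‖toPlane x‖ ^ 2) ν
  generates : AddSubgroup.closure (stepSupport ν) = ⊤
  stronglyAperiodic : ∀ z : Lattice,
    AddSubgroup.closure ((fun x => z + x) '' stepSupport ν) = ⊤

/-- The Fourier transform `f̂(p) = ∫ e^{-i p·x} f(x) dx`. -/
def fourierHat (f : Plane → ℝ) (p : Plane) : ℂ :=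
  ∫ x : Plane, Complex.exp (-(Complex.I * ((inner ℝ p x : ℝ) : ℂ))) * (f x : ℂ)

/-- A symmetric probability density in the Schwartz space of `ℝ²` whose Fourier transform
vanishes outside `(-π, π)²`. -/
structure IsBandLimitedDensity (f : 𝓢(Plane, ℝ)) : Prop where
  nonneg : ∀ x, 0 ≤ f x
  symmetric : ∀ x, f (-x) = f x
  integral_eq_one : ∫ x, f x = 1
  fourier_support : ∀ p : Plane, fourierHat f p ≠ 0 →
    ∀ i, p i ∈ Set.Ioo (-Real.pi) Real.pi

/-- `f_r(x) = r⁻² f(r⁻¹ x)`. -/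
def rescale (f : Plane → ℝ) (r : ℝ) (x : Plane) : ℝ := (r ^ 2)⁻¹ * f (r⁻¹ • x)

/-- The lattice convolution `(g ⊛ g)(y) = ∑_{x ∈ ℤ²} g(x) g(y - x)`. -/
def latticeConv (g : Plane → ℝ) (y : Plane) : ℝ :=
  ∑' x : Lattice, g (toPlane x) * g (y - toPlane x)

/-- The position after `n` steps of the walk started at `0` with the given steps. -/
def walk {Ω : Type*} (X : ℕ → Ω → Lattice) (n : ℕ) (ω : Ω) : Lattice :=
  ∑ k ∈ Finset.range n, X k ω

/-- `I_n(y)`, the number of `(n₁, n₂) ∈ {1, …, n}²` with `S₁(n₁) = S₂(n₂) + y`. -/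
def intersectionCount {Ω : Type*} (S₁ S₂ : ℕ → Ω → Lattice) (n : ℕ) (y : Lattice) (ω : Ω) : ℝ :=
  ∑ n₁ ∈ Finset.Icc 1 n, ∑ n₂ ∈ Finset.Icc 1 n,
    if S₁ n₁ ω = S₂ n₂ ω + y then 1 else 0

/-- The sum over `(n₁, n₂) ∈ {1, …, n}²` of `(f_r ⊛ f_r)(S₂(n₂) - S₁(n₁) + y)`. -/
def smoothedCount {Ω : Type*} (S₁ S₂ : ℕ → Ω → Lattice) (f : Plane → ℝ) (r : ℝ) (n : ℕ)
    (y : Lattice) (ω : Ω) : ℝ :=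
  ∑ n₁ ∈ Finset.Icc 1 n, ∑ n₂ ∈ Finset.Icc 1 n,
    latticeConv (rescale f r) (toPlane (S₂ n₂ ω - S₁ n₁ ω + y))

end PlanarWalk

end

/-! Everything happens on the dual torus. The difference of the two counts is `∫ (1 - ĝ²) e(y·p) U₂
conj(U₁) dp`, where `Uᵢ` is the Fourier transform of the occupation measure of the i-th walk and `ĝ`
is the Fourier series of `f_r` restricted to the lattice (`crossIntegral_kernelRatio`). The factor
`1 - ĝ²` is dominated by a density `min 5 (α + β D(p))`, with `α` a Riemann sum error tending to
zero and `β` of order `ε √t`, `t = n / b_n`. What remains, including the phase `e(y·p)`, has modulus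
at most 1, so all bounds are uniform in `y`.

The walks are independent with the same law, so even moments of such an integral are at most squared
`L²` norms of the multi-frequency transform of one walk (`lintegral_pow_crossIntegral_le`).
Expanding the exponential in even powers leaves the exponential generating function of these norms
at `θ = 2λ/√t` (`lintegral_exp_mul_sqrt_le`). That function is submultiplicative in the number of
steps (`transformGenFun_add_le`), so cutting the walk into at most `2 k b_n + 1` blocks of about `t
/ k` steps reduces the claim to a bound `1 + η` for one block.

For a block of `N` steps, strong aperiodicity gives a Gaussian bound on the characteristic function
(`exists_norm_stepChar_le`), hence `∫ G_N² = O(N)` and `∫ D G_N² = O(√N)` for the Green-type sum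
`G_N`. Removing the earliest time repeatedly yields squared norms at most `(m!)² (5CN)^m`
(`momentBoundSq_le`), so the series converges geometrically once `k` is large. At order two one
integral sees the weight `α + β D` unshifted, which gives the small bound `O(N²)(α + ε√k)`. A
Cauchy–Schwarz step (`transformNorm_succ_sq_le`) passes this smallness on to every positive order.
With `η` a small multiple of `δ / k`, the total cost is at most `exp(δ b_n)`. The lower bound is
trivial, since the exponentials are at least 1. -/

noncomputable section

namespace PlanarWalk

/-! ### Characters of the lattice on the dual torus -/

section Torus

/-- The torus `(ℝ/ℤ)²`, the dual group of `ℤ²`. -/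
abbrev Torus : Type := Fin 2 → UnitAddCircle

/-- The duality pairing `x · p ∈ ℝ/ℤ`. -/
def pairing (x : Lattice) (p : Torus) : UnitAddCircle := ∑ i, x i • p i

/-- The character `e^{2πi x·p}`. -/
def character (x : Lattice) (p : Torus) : ℂ := (AddCircle.toCircle (pairing x p) : ℂ)

lemma pairing_add_left (x y : Lattice) (p : Torus) :
    pairing (x + y) p = pairing x p + pairing y p := by
  simp [pairing, add_smul, Finset.sum_add_distrib]

lemma pairing_add_right (x : Lattice) (p q : Torus) :
    pairing x (p + q) = pairing x p + pairing x q := by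
  simp [pairing, smul_add, Finset.sum_add_distrib]

lemma character_add_left (x y : Lattice) (p : Torus) :
    character (x + y) p = character x p * character y p := by
  simp [character, pairing_add_left, AddCircle.toCircle_add]

lemma character_add_right (x : Lattice) (p q : Torus) :
    character x (p + q) = character x p * character x q := by
  simp [character, pairing_add_right, AddCircle.toCircle_add]

@[simp] lemma character_zero_left (p : Torus) : character 0 p = 1 := by
  simp [character, pairing]

@[simp] lemma character_zero_right (x : Lattice) : character x 0 = 1 := by
  simp [character, pairing]

@[simp] lemma norm_character (x : Lattice) (p : Torus) : ‖character x p‖ = 1 :=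
  Circle.norm_coe _

lemma character_neg_left (x : Lattice) (p : Torus) :
    character (-x) p = (starRingEnd ℂ) (character x p) := by
  have : pairing (-x) p = -pairing x p := by simp [pairing]
  rw [character, this, AddCircle.toCircle_neg, Circle.coe_inv_eq_conj, character]

lemma character_neg_right (x : Lattice) (p : Torus) :
    character x (-p) = (starRingEnd ℂ) (character x p) := by
  have : pairing x (-p) = -pairing x p := by simp [pairing]
  rw [character, this, AddCircle.toCircle_neg, Circle.coe_inv_eq_conj, character]

lemma character_sum_left {ι : Type*} (s : Finset ι) (x : ι → Lattice) (p : Torus) :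
    character (∑ i ∈ s, x i) p = ∏ i ∈ s, character (x i) p := by
  classical
  induction s using Finset.induction_on with
  | empty => simp
  | insert a s ha ih => rw [Finset.sum_insert ha, Finset.prod_insert ha, character_add_left, ih]

lemma character_sum_right {ι : Type*} (s : Finset ι) (x : Lattice) (p : ι → Torus) :
    character x (∑ i ∈ s, p i) = ∏ i ∈ s, character x (p i) := by
  classical
  induction s using Finset.induction_on with
  | empty => simp
  | insert a s ha ih => rw [Finset.sum_insert ha, Finset.prod_insert ha, character_add_right, ih]

lemma continuous_pairing (x : Lattice) : Continuous (pairing x) := by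
  unfold pairing; fun_prop

lemma continuous_character (x : Lattice) : Continuous (character x) :=
  continuous_subtype_val.comp (AddCircle.continuous_toCircle.comp (continuous_pairing x))

lemma measurable_character_prod :
    Measurable (fun z : Lattice × Torus => character z.1 z.2) :=
  measurable_from_prod_countable_right fun x => (continuous_character x).measurable

lemma norm_toCircle_sub_one (u : UnitAddCircle) :
    ‖(AddCircle.toCircle u : ℂ) - 1‖ = 2 * Real.sin (Real.pi * ‖u‖) := by
  obtain ⟨x, hx⟩ : ∃ x : ℝ, (x : UnitAddCircle) = u ∧ |x| ≤ 1 / 2 := by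
    obtain ⟨y, rfl⟩ := QuotientAddGroup.mk_surjective u
    refine ⟨y - round y, ?_, abs_sub_round y⟩
    have : ((y - round y : ℝ) : UnitAddCircle) = (y : UnitAddCircle) := by
      rw [AddCircle.coe_sub, sub_eq_self]
      exact (AddCircle.coe_eq_zero_iff (1 : ℝ)).2 ⟨round y, by simp⟩
    exact this
  obtain ⟨rfl, hx⟩ := hx
  have h1 : ‖(x : UnitAddCircle)‖ = |x| :=
    (AddCircle.norm_coe_eq_abs_iff (1 : ℝ) one_ne_zero).2 (by simpa using hx)
  rw [h1, AddCircle.toCircle_apply_mk, Circle.coe_exp]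
  have h2 := Complex.norm_exp_I_mul_ofReal_sub_one (x := 2 * Real.pi / 1 * x)
  rw [mul_comm] at h2
  rw [h2]
  have h3 : 2 * Real.pi / 1 * x / 2 = Real.pi * x := by ring
  rw [h3, Real.norm_eq_abs, abs_mul, abs_two]
  congr 1
  have h4 : |x| = x ∨ |x| = -x := abs_choice x
  have hpi := Real.pi_pos
  have h5 : 0 ≤ Real.sin (Real.pi * |x|) := by
    apply Real.sin_nonneg_of_nonneg_of_le_pi (by positivity)
    nlinarith [abs_nonneg x]
  rcases h4 with h | h
  · rw [h] at h5 ⊢; exact abs_of_nonneg h5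
  · rw [h] at h5 ⊢
    rw [mul_neg, Real.sin_neg] at h5 ⊢
    rw [abs_of_nonpos (by linarith)]

lemma le_norm_toCircle_sub_one (u : UnitAddCircle) :
    4 * ‖u‖ ≤ ‖(AddCircle.toCircle u : ℂ) - 1‖ := by
  rw [norm_toCircle_sub_one]
  have hu : ‖u‖ ≤ 1 / 2 := by
    simpa using AddCircle.norm_le_half_period (1 : ℝ) (x := u) one_ne_zero
  have hpi := Real.pi_pos
  have := Real.mul_le_sin (x := Real.pi * ‖u‖) (by positivity) (by nlinarith)
  have h : 2 / Real.pi * (Real.pi * ‖u‖) = 2 * ‖u‖ := by field_simp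
  linarith

lemma norm_toCircle_sub_one_le (u : UnitAddCircle) :
    ‖(AddCircle.toCircle u : ℂ) - 1‖ ≤ 2 * Real.pi * ‖u‖ := by
  rw [norm_toCircle_sub_one]
  have := Real.sin_le (x := Real.pi * ‖u‖) (by positivity)
  linarith

lemma norm_character_add_sub_one_le (x y : Lattice) (p : Torus) :
    ‖character (x + y) p - 1‖ ≤ ‖character x p - 1‖ + ‖character y p - 1‖ := by
  have : character (x + y) p - 1 = (character x p - 1) + character x p * (character y p - 1) := by
    rw [character_add_left]; ring
  rw [this]
  refine (norm_add_le _ _).trans ?_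
  simp

/-- The distance-like function `‖p₀‖ + ‖p₁‖` on the torus. -/
def torusDist (p : Torus) : ℝ := ‖p 0‖ + ‖p 1‖

lemma torusDist_nonneg (p : Torus) : 0 ≤ torusDist p := by unfold torusDist; positivity

lemma continuous_torusDist : Continuous torusDist := by unfold torusDist; fun_prop

lemma torusDist_neg (p : Torus) : torusDist (-p) = torusDist p := by simp [torusDist]

lemma norm_toPlane_sq (x : Lattice) : ‖toPlane x‖ ^ 2 = (x 0 : ℝ) ^ 2 + (x 1 : ℝ) ^ 2 := by
  simp [EuclideanSpace.norm_sq_eq, toPlane, Fin.sum_univ_two]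

lemma norm_character_sub_one_le (x : Lattice) (p : Torus) :
    ‖character x p - 1‖ ≤ 2 * Real.pi * (‖toPlane x‖ * torusDist p) := by
  refine (norm_toCircle_sub_one_le _).trans ?_
  have h (i : Fin 2) : |(x i : ℝ)| ≤ ‖toPlane x‖ := by
    apply abs_le_of_sq_le_sq _ (norm_nonneg _)
    rw [norm_toPlane_sq]
    fin_cases i <;> simp [sq_nonneg]
  have h2 (i : Fin 2) : ‖x i • p i‖ ≤ ‖toPlane x‖ * ‖p i‖ := by
    refine (norm_zsmul_le (n := x i) (a := p i)).trans ?_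
    gcongr
    rw [Int.norm_eq_abs]; exact h i
  have : ‖pairing x p‖ ≤ ‖toPlane x‖ * torusDist p := by
    rw [pairing, Fin.sum_univ_two, torusDist, mul_add]
    exact (norm_add_le _ _).trans (add_le_add (h2 0) (h2 1))
  have hpi := Real.pi_pos
  gcongr

instance : IsProbabilityMeasure (volume : Measure UnitAddCircle) :=
  ⟨UnitAddCircle.measure_univ⟩

lemma integral_character (x : Lattice) :
    ∫ p, character x p = if x = 0 then (1 : ℂ) else 0 := by
  split_ifs with hx
  · simp [hx]
  · obtain ⟨i, hi⟩ : ∃ i, x i ≠ 0 := by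
      by_contra! h; exact hx (funext h)
    have hi' : (x i : ℝ) ≠ 0 := by exact_mod_cast hi
    -- Translation by a point where the character is -1 turns the integral into its negative.
    let q : Torus := Pi.single i (((1 / (2 * x i) : ℝ)) : UnitAddCircle)
    have hq : character x q = -1 := by
      have : pairing x q = ((1 / 2 : ℝ) : UnitAddCircle) := by
        simp only [pairing, q]
        rw [Finset.sum_eq_single i]
        · rw [Pi.single_eq_same, ← AddCircle.coe_zsmul]
          congr 1
          simp; field_simp
        · intro j _ hj; simp [Pi.single_eq_of_ne hj]
        · simp
      rw [character, this, AddCircle.toCircle_apply_mk, Circle.coe_exp]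
      have : ((2 * Real.pi / 1 * (1 / 2) : ℝ) : ℂ) * Complex.I = Real.pi * Complex.I := by
        push_cast; ring
      rw [this, Complex.exp_pi_mul_I]
    have h := integral_add_right_eq_self (μ := (volume : Measure Torus)) (character x) q
    simp_rw [character_add_right, hq] at h
    rw [integral_mul_const] at h
    linear_combination (-1 / 2 : ℂ) * h

/-- The Gaussian integral over the torus. -/
lemma integral_exp_neg_mul_torus_le {c : ℝ} (hc : 0 < c) :
    ∫ p : Torus, Real.exp (-c * (‖p 0‖ ^ 2 + ‖p 1‖ ^ 2)) ≤ Real.pi / c := by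
  have h1 : ∀ p : Torus, Real.exp (-c * (‖p 0‖ ^ 2 + ‖p 1‖ ^ 2))
      = ∏ i, Real.exp (-c * ‖p i‖ ^ 2) := by
    intro p; rw [Fin.prod_univ_two, ← Real.exp_add]; ring_nf
  simp_rw [h1]
  rw [integral_fintype_prod_volume_eq_pow (fun u : UnitAddCircle => Real.exp (-c * ‖u‖ ^ 2)),
    Fintype.card_fin]
  have h2 : ∫ u : UnitAddCircle, Real.exp (-c * ‖u‖ ^ 2) ≤ √(Real.pi / c) := by
    rw [← UnitAddCircle.intervalIntegral_preimage (-1 / 2), ← integral_gaussian]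
    rw [intervalIntegral.integral_of_le (by norm_num)]
    have : ∫ x in Set.Ioc (-1 / 2 : ℝ) (-1 / 2 + 1), Real.exp (-c * ‖(x : UnitAddCircle)‖ ^ 2)
        = ∫ x in Set.Ioc (-1 / 2 : ℝ) (-1 / 2 + 1), Real.exp (-c * x ^ 2) := by
      refine setIntegral_congr_fun measurableSet_Ioc fun x hx => ?_
      have : ‖(x : UnitAddCircle)‖ = |x| :=
        (AddCircle.norm_coe_eq_abs_iff (1 : ℝ) one_ne_zero).2
          (abs_le.2 ⟨by norm_num; linarith [hx.1], by norm_num; linarith [hx.2]⟩)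
      simp only [this, sq_abs]
    rw [this]
    exact setIntegral_le_integral (integrable_exp_neg_mul_sq hc)
      (ae_of_all _ fun x => (Real.exp_pos _).le)
  calc _ ≤ √(Real.pi / c) ^ 2 := by
        gcongr
    _ = _ := Real.sq_sqrt (by positivity)

end Torus

/-! ### Gaussian decay of the characteristic function and Green-type sums -/

section GreenBound

variable (ν : Measure Lattice)

/-- The characteristic function of the step law, as a function on the torus. -/
def stepChar (p : Torus) : ℂ := ∫ x, character x p ∂ν

lemma measurable_character_left (p : Torus) : Measurable (fun x => character x p) :=
  measurable_of_countable _

lemma integrable_character [IsFiniteMeasure ν] (p : Torus) :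
    Integrable (fun x => character x p) ν :=
  Integrable.of_bound (measurable_character_left p).aestronglyMeasurable 1
    (ae_of_all _ fun x => (norm_character x p).le)

lemma norm_stepChar_le_one [IsProbabilityMeasure ν] (p : Torus) : ‖stepChar ν p‖ ≤ 1 := by
  refine (norm_integral_le_integral_norm _).trans ?_
  simp

@[simp] lemma stepChar_zero [IsProbabilityMeasure ν] : stepChar ν 0 = 1 := by
  simp [stepChar]

lemma stepChar_neg (p : Torus) : stepChar ν (-p) = (starRingEnd ℂ) (stepChar ν p) := by
  simp only [stepChar, character_neg_right]
  exact integral_conj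

lemma continuous_stepChar [IsFiniteMeasure ν] : Continuous (stepChar ν) :=
  continuous_of_dominated (bound := fun _ => 1)
    (fun p => (measurable_character_left p).aestronglyMeasurable)
    (fun p => ae_of_all _ fun x => (norm_character x p).le) (integrable_const _)
    (ae_of_all _ fun x => continuous_character x)

/-- This is the variance of the unimodular variable `e(x·p)`, whose mean is `φ(p)`. It forces the
character at each atom of the law to be close to `φ(p)` whenever `|φ(p)|` is close to 1. -/
lemma integral_norm_character_sub_stepChar_sq [IsProbabilityMeasure ν] (p : Torus) :
    ∫ x, ‖character x p - stepChar ν p‖ ^ 2 ∂ν = 1 - ‖stepChar ν p‖ ^ 2 := by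
  have h (x : Lattice) : ‖character x p - stepChar ν p‖ ^ 2
      = (1 + ‖stepChar ν p‖ ^ 2)
        - 2 * RCLike.re (character x p * (starRingEnd ℂ) (stepChar ν p)) := by
    rw [← Complex.normSq_eq_norm_sq, Complex.normSq_sub, Complex.normSq_eq_norm_sq,
      Complex.normSq_eq_norm_sq, norm_character]
    simp
  have hi : Integrable (fun x => character x p * (starRingEnd ℂ) (stepChar ν p)) ν :=
    (integrable_character ν p).mul_const _
  simp_rw [h]
  rw [integral_sub (integrable_const _) (hi.re.const_mul 2), integral_const, integral_const_mul,
    integral_re hi, integral_mul_const]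
  change _ - 2 * (stepChar ν p * (starRingEnd ℂ) (stepChar ν p)).re = _
  rw [Complex.mul_conj, Complex.normSq_eq_norm_sq, Complex.ofReal_re]
  simp; ring

lemma measureReal_mul_norm_character_sub_stepChar_sq_le [IsProbabilityMeasure ν] (x : Lattice)
    (p : Torus) :
    ν.real {x} * ‖character x p - stepChar ν p‖ ^ 2 ≤ 1 - ‖stepChar ν p‖ ^ 2 := by
  rw [← integral_norm_character_sub_stepChar_sq]
  have hi : Integrable (fun x => ‖character x p - stepChar ν p‖ ^ 2) ν :=
    Integrable.of_bound (measurable_of_countable _).aestronglyMeasurable 4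
      (ae_of_all _ fun x => by
        rw [Real.norm_of_nonneg (by positivity)]
        have : ‖character x p - stepChar ν p‖ ≤ 1 + 1 :=
          (norm_sub_le _ _).trans (add_le_add (norm_character x p).le (norm_stepChar_le_one ν p))
        nlinarith [norm_nonneg (character x p - stepChar ν p)])
  have := setIntegral_le_integral (s := {x}) hi (ae_of_all _ fun x => by positivity)
  rwa [integral_singleton, smul_eq_mul] at this

/-- The set of `y` whose character deviates from `1` at most by a multiple of
`(1 - |φ|²)^{1/2}`. -/
def controlledSubgroup [IsProbabilityMeasure ν] : AddSubgroup Lattice where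
  carrier := {y | ∃ C : ℝ, 0 ≤ C ∧
    ∀ p, ‖character y p - 1‖ ^ 2 ≤ C * (1 - ‖stepChar ν p‖ ^ 2)}
  zero_mem' := ⟨0, le_rfl, by simp⟩
  add_mem' := by
    rintro x y ⟨C, hC, hx⟩ ⟨D, hD, hy⟩
    refine ⟨2 * (C + D), by positivity, fun p => ?_⟩
    have := norm_character_add_sub_one_le x y p
    have h2 := pow_le_pow_left₀ (norm_nonneg _) this 2
    have := hx p
    have := hy p
    nlinarith [sq_nonneg (‖character x p - 1‖ - ‖character y p - 1‖)]
  neg_mem' := by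
    rintro x ⟨C, hC, hx⟩
    refine ⟨C, hC, fun p => ?_⟩
    have : character (-x) p - 1 = (starRingEnd ℂ) (character x p - 1) := by
      rw [character_neg_left]; simp
    rw [this, RCLike.norm_conj]
    exact hx p

variable {ν}

/-- At two atoms the characters are both within `O((1 - |φ|²)^{1/2})` of `φ(p)`, so differences of
atoms are controlled. Strong aperiodicity, applied with the translate by `-x₀` for an atom `x₀`,
says that these differences generate the lattice. -/
lemma IsAdmissibleStep.controlledSubgroup_eq_top [IsProbabilityMeasure ν]
    (hν : IsAdmissibleStep ν) : controlledSubgroup ν = ⊤ := by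
  obtain ⟨x₀, hx₀⟩ : (stepSupport ν).Nonempty := by
    rw [Set.nonempty_iff_ne_empty]
    intro h
    have h1 := hν.generates
    rw [h, AddSubgroup.closure_empty] at h1
    exact bot_ne_top h1
  rw [eq_top_iff, ← hν.stronglyAperiodic (-x₀), AddSubgroup.closure_le]
  rintro _ ⟨x, hx, rfl⟩
  have ha : 0 < ν.real {x} := ENNReal.toReal_pos hx (measure_ne_top _ _)
  have hb : 0 < ν.real {x₀} := ENNReal.toReal_pos hx₀ (measure_ne_top _ _)
  refine ⟨2 * (1 / ν.real {x} + 1 / ν.real {x₀}), by positivity, fun p => ?_⟩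
  have h1 : ‖character x p - stepChar ν p‖ ^ 2 ≤ 1 / ν.real {x} * (1 - ‖stepChar ν p‖ ^ 2) := by
    rw [div_mul_eq_mul_div, one_mul, le_div_iff₀' ha]
    exact measureReal_mul_norm_character_sub_stepChar_sq_le ν x p
  have h2 : ‖character x₀ p - stepChar ν p‖ ^ 2
      ≤ 1 / ν.real {x₀} * (1 - ‖stepChar ν p‖ ^ 2) := by
    rw [div_mul_eq_mul_div, one_mul, le_div_iff₀' hb]
    exact measureReal_mul_norm_character_sub_stepChar_sq_le ν x₀ p
  have h3 : ‖character (-x₀ + x) p - 1‖ = ‖character x p - character x₀ p‖ := by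
    have : character x p - character x₀ p = character x₀ p * (character (-x₀ + x) p - 1) := by
      rw [mul_sub, ← character_add_left]; simp
    rw [this, norm_mul, norm_character, one_mul]
  have h4 : ‖character x p - character x₀ p‖
      ≤ ‖character x p - stepChar ν p‖ + ‖character x₀ p - stepChar ν p‖ := by
    have := norm_sub_le (character x p - stepChar ν p) (character x₀ p - stepChar ν p)
    rwa [sub_sub_sub_cancel_right] at this
  simp only [h3]
  have h5 := pow_le_pow_left₀ (norm_nonneg _) h4 2
  nlinarith [sq_nonneg (‖character x p - stepChar ν p‖ - ‖character x₀ p - stepChar ν p‖)]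

/-- Control of the two unit vectors bounds `‖p₀‖² + ‖p₁‖²` by a multiple of `1 - |φ|²`, and `1 - x ≤
e^{-x}` does the rest. The bound is global on the torus, not only near the origin. -/
lemma IsAdmissibleStep.exists_norm_stepChar_le [IsProbabilityMeasure ν]
    (hν : IsAdmissibleStep ν) :
    ∃ c : ℝ, 0 < c ∧ ∀ p, ‖stepChar ν p‖ ≤ Real.exp (-c * (‖p 0‖ ^ 2 + ‖p 1‖ ^ 2)) := by
  have key (i : Fin 2) : ∃ C : ℝ, 0 ≤ C ∧ ∀ p : Torus,
      ‖p i‖ ^ 2 ≤ C * (1 - ‖stepChar ν p‖ ^ 2) := by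
    obtain ⟨C, hC, h⟩ : Pi.single i 1 ∈ controlledSubgroup ν := by
      rw [hν.controlledSubgroup_eq_top]; trivial
    refine ⟨C, hC, fun p => ?_⟩
    refine le_trans ?_ (h p)
    have h1 : pairing (Pi.single i 1) p = p i := by
      rw [pairing, Finset.sum_eq_single i]
      · simp
      · intro j _ hj; simp [Pi.single_eq_of_ne hj]
      · simp
    have h2 := le_norm_toCircle_sub_one (p i)
    rw [character, h1]
    gcongr
    linarith [norm_nonneg (p i)]
  obtain ⟨C, hC, h0⟩ := key 0
  obtain ⟨C', hC', h1⟩ := key 1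
  -- The 2 comes from taking the square root of a bound on `|φ|²`; the 1 keeps the denominator
  -- positive.
  refine ⟨1 / (2 * (C + C' + 1)), by positivity, fun p => ?_⟩
  have h2 : (‖p 0‖ ^ 2 + ‖p 1‖ ^ 2) ≤ (C + C' + 1) * (1 - ‖stepChar ν p‖ ^ 2) := by
    have : ‖stepChar ν p‖ ^ 2 ≤ 1 := pow_le_one₀ (norm_nonneg _) (norm_stepChar_le_one ν p)
    nlinarith [h0 p, h1 p]
  apply le_of_sq_le_sq _ (Real.exp_pos _).le
  have h3 : (‖p 0‖ ^ 2 + ‖p 1‖ ^ 2) / (C + C' + 1) ≤ 1 - ‖stepChar ν p‖ ^ 2 := by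
    rwa [div_le_iff₀' (by positivity)]
  rw [← Real.exp_nat_mul]
  have h4 := Real.add_one_le_exp (-((‖p 0‖ ^ 2 + ‖p 1‖ ^ 2) / (C + C' + 1)))
  have h5 : (2 : ℕ) * (-(1 / (2 * (C + C' + 1))) * (‖p 0‖ ^ 2 + ‖p 1‖ ^ 2))
      = -((‖p 0‖ ^ 2 + ‖p 1‖ ^ 2) / (C + C' + 1)) := by
    push_cast; field_simp
  rw [h5]; linarith

variable (ν)

/-- `∑_{j ≤ N} |φ(p)|^j`. -/
def greenBound (N : ℕ) (p : Torus) : ℝ := ∑ j ∈ Finset.range (N + 1), ‖stepChar ν p‖ ^ j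

lemma greenBound_nonneg (N : ℕ) (p : Torus) : 0 ≤ greenBound ν N p := by
  unfold greenBound; positivity

lemma continuous_greenBound [IsFiniteMeasure ν] (N : ℕ) : Continuous (greenBound ν N) := by
  have := continuous_stepChar ν
  unfold greenBound; fun_prop

/-- A value `s` is the sum of at most `s + 1` pairs. -/
lemma sum_range_sum_range_add_le (a : ℕ → ℝ) (ha : ∀ s, 0 ≤ a s) (N : ℕ) :
    ∑ i ∈ Finset.range (N + 1), ∑ j ∈ Finset.range (N + 1), a (i + j)
      ≤ ∑ s ∈ Finset.range (2 * N + 1), (s + 1 : ℝ) * a s := by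
  rw [← Finset.sum_product', ← Finset.sum_fiberwise_of_maps_to
    (t := Finset.range (2 * N + 1)) (g := fun q : ℕ × ℕ => q.1 + q.2)]
  · refine Finset.sum_le_sum fun s _ => ?_
    calc _ ≤ ∑ q ∈ Finset.HasAntidiagonal.antidiagonal s, a (q.1 + q.2) := by
          refine Finset.sum_le_sum_of_subset_of_nonneg (fun q hq => ?_) fun _ _ _ => ha _
          simp at hq ⊢; exact hq.2
      _ = ∑ q ∈ Finset.HasAntidiagonal.antidiagonal s, a s :=
          Finset.sum_congr rfl fun q hq => by rw [Finset.HasAntidiagonal.mem_antidiagonal.1 hq]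
      _ = _ := by simp
  · intro q hq
    simp at hq ⊢; omega

lemma integrable_of_continuous_torus {g : Torus → ℝ} (hg : Continuous g) :
    Integrable g := by
  obtain ⟨C, hC⟩ := isCompact_univ.exists_bound_of_continuousOn hg.continuousOn
  exact Integrable.of_bound hg.aestronglyMeasurable C (ae_of_all _ fun x => hC x trivial)

lemma integral_mul_greenBound_sq_le [IsProbabilityMeasure ν] {g : Torus → ℝ}
    (hg : Continuous g) (hg0 : ∀ p, 0 ≤ g p) (N : ℕ) :
    ∫ p, g p * greenBound ν N p ^ 2
      ≤ ∑ s ∈ Finset.range (2 * N + 1), (s + 1 : ℝ) * ∫ p, g p * ‖stepChar ν p‖ ^ s := by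
  have hφ := continuous_stepChar ν
  refine le_trans (le_of_eq ?_) (sum_range_sum_range_add_le
    (fun s => ∫ p, g p * ‖stepChar ν p‖ ^ s)
    (fun s => integral_nonneg fun p => mul_nonneg (hg0 p) (by positivity)) N)
  simp_rw [greenBound, sq, Finset.sum_mul_sum, Finset.mul_sum, ← pow_add]
  rw [integral_finsetSum _ fun i _ => integrable_of_continuous_torus (by fun_prop)]
  refine Finset.sum_congr rfl fun i _ => ?_
  rw [integral_finsetSum _ fun i _ => integrable_of_continuous_torus (by fun_prop)]

variable {ν}

/-- The torus is bounded, so a constant `e^c` pays for replacing `s` by `s + 1` in the exponent;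
this makes the case `s = 0` uniform with the others. -/
lemma norm_stepChar_pow_le {c : ℝ} (hc : 0 < c)
    (h : ∀ p, ‖stepChar ν p‖ ≤ Real.exp (-c * (‖p 0‖ ^ 2 + ‖p 1‖ ^ 2))) (s : ℕ) (p : Torus) :
    ‖stepChar ν p‖ ^ s
      ≤ Real.exp c * Real.exp (-(c * (s + 1)) * (‖p 0‖ ^ 2 + ‖p 1‖ ^ 2)) := by
  have hp (i) : ‖p i‖ ≤ 1 / 2 := by
    simpa using AddCircle.norm_le_half_period (1 : ℝ) (x := p i) one_ne_zero
  have h2 : ‖p 0‖ ^ 2 + ‖p 1‖ ^ 2 ≤ 1 := by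
    nlinarith [hp 0, hp 1, norm_nonneg (p 0), norm_nonneg (p 1)]
  refine (pow_le_pow_left₀ (norm_nonneg _) (h p) s).trans ?_
  rw [← Real.exp_nat_mul, ← Real.exp_add]
  apply Real.exp_le_exp.2
  nlinarith

/-- In two dimensions `∫ |φ|^s = O(1/(s+1))`, which exactly cancels the multiplicity `s + 1`,
leaving `2N + 1` bounded terms. -/
lemma IsAdmissibleStep.exists_integral_greenBound_sq_le [IsProbabilityMeasure ν]
    (hν : IsAdmissibleStep ν) : ∃ C : ℝ, 0 < C ∧ ∀ N : ℕ, 1 ≤ N →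
      ∫ p, greenBound ν N p ^ 2 ≤ C * N := by
  obtain ⟨c, hc, h⟩ := hν.exists_norm_stepChar_le
  have hpi := Real.pi_pos
  refine ⟨3 * (Real.exp c * (Real.pi / c)), by positivity, fun N hN => ?_⟩
  have h1 := integral_mul_greenBound_sq_le ν (g := fun _ => 1) continuous_const (by simp) N
  simp only [one_mul] at h1
  refine h1.trans ?_
  have h2 (s : ℕ) : (s + 1 : ℝ) * ∫ p, ‖stepChar ν p‖ ^ s ≤ Real.exp c * (Real.pi / c) := by
    have : ∫ p, ‖stepChar ν p‖ ^ s ≤ Real.exp c * (Real.pi / (c * (s + 1))) := by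
      refine (integral_mono ?_ ?_ (norm_stepChar_pow_le hc h s)).trans ?_
      · have := continuous_stepChar ν
        exact integrable_of_continuous_torus (by fun_prop)
      · exact integrable_of_continuous_torus (by fun_prop)
      · rw [integral_const_mul]
        gcongr
        exact integral_exp_neg_mul_torus_le (by positivity)
    calc _ ≤ (s + 1 : ℝ) * (Real.exp c * (Real.pi / (c * (s + 1)))) := by gcongr
      _ = _ := by field_simp
  refine (Finset.sum_le_sum fun s _ => h2 s).trans ?_
  rw [Finset.sum_const, Finset.card_range, nsmul_eq_mul]
  have hN' : (1 : ℝ) ≤ N := by exact_mod_cast hN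
  have : ((2 * N + 1 : ℕ) : ℝ) ≤ 3 * N := by push_cast; linarith
  calc _ ≤ 3 * (N : ℝ) * (Real.exp c * (Real.pi / c)) := by gcongr
    _ = _ := by ring

lemma sum_range_inv_sqrt_le (M : ℕ) :
    ∑ s ∈ Finset.range M, (√(s + 1 : ℝ))⁻¹ ≤ 2 * √M := by
  induction M with
  | zero => simp
  | succ M ih =>
    rw [Finset.sum_range_succ]
    have h1 : 0 < √(M + 1 : ℝ) := by positivity
    have h2 := Real.sq_sqrt (x := (M + 1 : ℝ)) (by positivity)
    have h3 := Real.sq_sqrt (x := (M : ℝ)) (by positivity)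
    have h4 : (√(M + 1 : ℝ))⁻¹ ≤ 2 * √(M + 1 : ℝ) - 2 * √M := by
      rw [inv_le_iff_one_le_mul₀ h1]
      nlinarith [sq_nonneg (√(M + 1 : ℝ) - √M)]
    push_cast
    linarith

/-- A factor that vanishes linearly at the origin gains `(s+1)^{-1/2}` in each term, so the sum
drops from `N` to `√N`. -/
lemma IsAdmissibleStep.exists_integral_torusDist_mul_greenBound_sq_le [IsProbabilityMeasure ν]
    (hν : IsAdmissibleStep ν) : ∃ C : ℝ, 0 < C ∧ ∀ N : ℕ, 1 ≤ N →
      ∫ p, torusDist p * greenBound ν N p ^ 2 ≤ C * √N := by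
  obtain ⟨c, hc, h⟩ := hν.exists_norm_stepChar_le
  have hpi := Real.pi_pos
  set K : ℝ := Real.exp c * ((2 / √c) * (Real.pi / (c / 2))) with hK
  have hK0 : 0 < K := by positivity
  refine ⟨4 * K, by positivity, fun N hN => ?_⟩
  refine (integral_mul_greenBound_sq_le ν continuous_torusDist torusDist_nonneg N).trans ?_
  have h2 (s : ℕ) : (s + 1 : ℝ) * ∫ p, torusDist p * ‖stepChar ν p‖ ^ s
      ≤ K * (√(s + 1 : ℝ))⁻¹ := by
    set a : ℝ := c * (s + 1) with ha
    have ha0 : 0 < a := by positivity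
    have h3 (p : Torus) : torusDist p * ‖stepChar ν p‖ ^ s
        ≤ Real.exp c * (2 / √a) * Real.exp (-(a / 2) * (‖p 0‖ ^ 2 + ‖p 1‖ ^ 2)) := by
      -- Half of the Gaussian exponent is spent on absorbing the factor `D(p)`.
      have h4 : torusDist p ≤ 2 / √a * Real.exp ((a / 2) * (‖p 0‖ ^ 2 + ‖p 1‖ ^ 2)) := by
        have h5 : √a * torusDist p ≤ 2 * (1 + (a / 2) * (‖p 0‖ ^ 2 + ‖p 1‖ ^ 2)) := by
          have h6 := Real.sq_sqrt ha0.le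
          unfold torusDist
          nlinarith [sq_nonneg (√a * ‖p 0‖ - 1), sq_nonneg (√a * ‖p 1‖ - 1),
            sq_nonneg (√a * ‖p 0‖), sq_nonneg (√a * ‖p 1‖)]
        have h7 := Real.add_one_le_exp ((a / 2) * (‖p 0‖ ^ 2 + ‖p 1‖ ^ 2))
        rw [div_mul_eq_mul_div, le_div_iff₀ (by positivity)]
        linarith
      calc _ ≤ (2 / √a * Real.exp ((a / 2) * (‖p 0‖ ^ 2 + ‖p 1‖ ^ 2)))
            * (Real.exp c * Real.exp (-a * (‖p 0‖ ^ 2 + ‖p 1‖ ^ 2))) := by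
            gcongr
            exact norm_stepChar_pow_le hc h s p
        _ = Real.exp c * (2 / √a) * (Real.exp ((a / 2) * (‖p 0‖ ^ 2 + ‖p 1‖ ^ 2))
            * Real.exp (-a * (‖p 0‖ ^ 2 + ‖p 1‖ ^ 2))) := by ring
        _ = _ := by
            rw [← Real.exp_add]; congr 2; ring
    have h8 : ∫ p, torusDist p * ‖stepChar ν p‖ ^ s
        ≤ Real.exp c * (2 / √a) * (Real.pi / (a / 2)) := by
      refine (integral_mono ?_ ?_ h3).trans ?_
      · have := continuous_stepChar ν
        have := continuous_torusDist
        exact integrable_of_continuous_torus (by fun_prop)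
      · exact integrable_of_continuous_torus (by fun_prop)
      · rw [integral_const_mul]
        gcongr
        exact integral_exp_neg_mul_torus_le (by positivity)
    calc _ ≤ (s + 1 : ℝ) * (Real.exp c * (2 / √a) * (Real.pi / (a / 2))) := by gcongr
      _ = _ := by
        rw [hK, ha, Real.sqrt_mul hc.le]
        field_simp
  refine (Finset.sum_le_sum fun s _ => h2 s).trans ?_
  rw [← Finset.mul_sum]
  have h9 := sum_range_inv_sqrt_le (2 * N + 1)
  have hN' : (1 : ℝ) ≤ N := by exact_mod_cast hN
  have h10 : √((2 * N + 1 : ℕ) : ℝ) ≤ 2 * √N := by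
    rw [Real.sqrt_le_left (by positivity), mul_pow, Real.sq_sqrt (by positivity)]
    push_cast; linarith
  calc _ ≤ K * (2 * (2 * √N)) := by gcongr; linarith
    _ = _ := by ring

end GreenBound

/-! ### Factorial bounds on multi-time sums without phase -/

section MomentBound

variable (ν : Measure Lattice)

/-- The modulus of `E ∏ⱼ e(S(nⱼ)·pⱼ)`, summed over all times `n₁, …, n_m ∈ {0, …, N}`. -/
def momentBound (N m : ℕ) (p : Fin m → Torus) : ℝ :=
  ∑ n ∈ Fintype.piFinset (fun _ : Fin m => Finset.range (N + 1)),
    ∏ k ∈ Finset.range N, ‖stepChar ν (∑ j with k < n j, p j)‖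

lemma momentBound_nonneg (N m : ℕ) (p : Fin m → Torus) : 0 ≤ momentBound ν N m p := by
  unfold momentBound; positivity

lemma continuous_momentBound [IsFiniteMeasure ν] (N m : ℕ) :
    Continuous (momentBound ν N m) := by
  have := continuous_stepChar ν
  unfold momentBound; fun_prop

lemma momentBound_zero [IsProbabilityMeasure ν] (N : ℕ) (p : Fin 0 → Torus) :
    momentBound ν N 0 p = 1 := by
  simp [momentBound]

/-- Up to the smallest time `n i` all frequencies are active and each step contributes `|φ(∑ p)|`.
Afterwards the clock restarts with frequency `i` removed. -/
lemma prod_norm_stepChar_eq_of_min [IsProbabilityMeasure ν] {N m : ℕ} (n : Fin (m + 1) → ℕ)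
    (hn : ∀ j, n j ≤ N) (i : Fin (m + 1)) (hi : ∀ j, n i ≤ n j) (p : Fin (m + 1) → Torus) :
    ∏ k ∈ Finset.range N, ‖stepChar ν (∑ j with k < n j, p j)‖
      = ‖stepChar ν (∑ j, p j)‖ ^ n i
        * ∏ k ∈ Finset.range N,
          ‖stepChar ν (∑ j with k < n (i.succAbove j) - n i, p (i.succAbove j))‖ := by
  obtain ⟨M, hM⟩ := Nat.exists_eq_add_of_le (hn i)
  have h1 : ∏ k ∈ Finset.range N, ‖stepChar ν (∑ j with k < n j, p j)‖
      = ‖stepChar ν (∑ j, p j)‖ ^ n i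
        * ∏ k ∈ Finset.range M, ‖stepChar ν (∑ j with n i + k < n j, p j)‖ := by
    rw [hM, Finset.prod_range_add]
    congr 1
    rw [← Finset.card_range (n i), ← Finset.prod_const, Finset.card_range]
    refine Finset.prod_congr rfl fun k hk => ?_
    rw [Finset.filter_true_of_mem fun j _ => (Finset.mem_range.1 hk).trans_le (hi j)]
  have h2 : ∏ k ∈ Finset.range N,
        ‖stepChar ν (∑ j with k < n (i.succAbove j) - n i, p (i.succAbove j))‖
      = ∏ k ∈ Finset.range M,
        ‖stepChar ν (∑ j with k < n (i.succAbove j) - n i, p (i.succAbove j))‖ := by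
    -- The factors beyond `M` have no active frequency and equal `|φ(0)| = 1`.
    rw [hM, add_comm, Finset.prod_range_add]
    convert mul_one _
    refine Finset.prod_eq_one fun k _ => ?_
    rw [Finset.filter_false_of_mem]
    · simp
    · intro j _
      have := hn (i.succAbove j)
      omega
  rw [h1, h2]
  congr 1
  refine Finset.prod_congr rfl fun k _ => ?_
  congr 2
  rw [Finset.sum_filter, Finset.sum_filter, Fin.sum_univ_succAbove _ i]
  simp only [add_lt_iff_neg_left, not_lt_zero, if_false, zero_add]
  refine Finset.sum_congr rfl fun j _ => ?_
  have := hi (i.succAbove j)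
  congr 1
  simp only [eq_iff_iff]; omega

/-- Sum over the index with the earliest time, then over that time, which gives the Green sum at the
total frequency, and over the remaining time differences. -/
lemma momentBound_succ_le [IsProbabilityMeasure ν] (N m : ℕ) (p : Fin (m + 1) → Torus) :
    momentBound ν N (m + 1) p
      ≤ greenBound ν N (∑ j, p j) * ∑ i : Fin (m + 1), momentBound ν N m (fun j => p (i.succAbove j)) := by
  classical
  set S := Fintype.piFinset (fun _ : Fin (m + 1) => Finset.range (N + 1)) with hS
  set F : (Fin (m + 1) → ℕ) → ℝ := fun n =>
    ∏ k ∈ Finset.range N, ‖stepChar ν (∑ j with k < n j, p j)‖ with hF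
  have hF0 : ∀ n, 0 ≤ F n := fun n => by positivity
  have h1 : momentBound ν N (m + 1) p ≤ ∑ i, ∑ n ∈ S with ∀ j, n i ≤ n j, F n := by
    simp_rw [Finset.sum_filter]
    rw [Finset.sum_comm]
    refine Finset.sum_le_sum fun n _ => ?_
    obtain ⟨i, hi⟩ := Finite.exists_min n
    refine le_trans ?_ (Finset.single_le_sum (fun i _ => ?_) (Finset.mem_univ i))
    · rw [if_pos hi]
    · split_ifs
      exacts [hF0 n, le_rfl]
  refine h1.trans ?_
  rw [Finset.mul_sum]
  refine Finset.sum_le_sum fun i _ => ?_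
  set G : ℕ × (Fin m → ℕ) → ℝ := fun q => ‖stepChar ν (∑ j, p j)‖ ^ q.1
    * ∏ k ∈ Finset.range N, ‖stepChar ν (∑ j with k < q.2 j, p (i.succAbove j))‖ with hG
  set e : (Fin (m + 1) → ℕ) → ℕ × (Fin m → ℕ) :=
    fun n => (n i, fun j => n (i.succAbove j) - n i) with he
  have h2 : ∑ n ∈ S with ∀ j, n i ≤ n j, F n = ∑ n ∈ S with ∀ j, n i ≤ n j, G (e n) := by
    refine Finset.sum_congr rfl fun n hn => ?_
    rw [Finset.mem_filter, hS, Fintype.mem_piFinset] at hn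
    exact prod_norm_stepChar_eq_of_min ν n
      (fun j => Nat.lt_succ_iff.1 (Finset.mem_range.1 (hn.1 j))) i hn.2 p
  -- Truncated subtraction loses nothing here, because `n i` is the minimum.
  have hinj : Set.InjOn e (S.filter fun n => ∀ j, n i ≤ n j) := by
    intro n hn n' hn' h
    simp only [Finset.coe_filter, Set.mem_ofPred_eq] at hn hn'
    simp only [he, Prod.mk.injEq] at h
    funext j
    rcases eq_or_ne j i with rfl | hj
    · exact h.1
    · obtain ⟨j, rfl⟩ := Fin.exists_succAbove_eq hj
      have := congrFun h.2 j
      have := hn.2 (i.succAbove j)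
      have := hn'.2 (i.succAbove j)
      omega
  rw [h2, ← Finset.sum_image (f := G) hinj]
  have h3 : greenBound ν N (∑ j, p j) * momentBound ν N m (fun j => p (i.succAbove j))
      = ∑ q ∈ Finset.range (N + 1) ×ˢ Fintype.piFinset (fun _ : Fin m => Finset.range (N + 1)),
        G q := by
    rw [greenBound, momentBound, Finset.sum_mul_sum, Finset.sum_product]
  rw [h3]
  refine Finset.sum_le_sum_of_subset_of_nonneg ?_ fun q _ _ => by positivity
  intro q hq
  obtain ⟨n, hn, rfl⟩ := Finset.mem_image.1 hq
  rw [Finset.mem_filter, hS, Fintype.mem_piFinset] at hn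
  simp only [he, Finset.mem_product, Fintype.mem_piFinset, Finset.mem_range] at hn ⊢
  refine ⟨hn.1 i, fun j => ?_⟩
  have := hn.1 (i.succAbove j)
  omega

variable (μ : Measure Torus)

/-- The squared `L²(μ^m)` norm of `momentBound`. -/
def momentBoundSq (N m : ℕ) : ℝ≥0∞ :=
  ∫⁻ p, ENNReal.ofReal (momentBound ν N m p) ^ 2 ∂(Measure.pi fun _ : Fin m => μ)

lemma momentBoundSq_zero [IsProbabilityMeasure ν] (N : ℕ) : momentBoundSq ν μ N 0 = 1 := by
  simp [momentBoundSq, momentBound_zero]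

/-- One factor `m + 1` comes from Cauchy–Schwarz over the choice of the earliest index, the other
from adding the resulting terms. The removed frequency is integrated first, with the others as a
shift; this is why `hh` is uniform in `a`. -/
lemma momentBoundSq_succ_le [IsProbabilityMeasure ν] [IsFiniteMeasure μ] {N : ℕ} {h : ℝ≥0∞}
    (hh : ∀ a, ∫⁻ p, ENNReal.ofReal (greenBound ν N (p + a)) ^ 2 ∂μ ≤ h) (m : ℕ) :
    momentBoundSq ν μ N (m + 1) ≤ ((m + 1 : ℕ) : ℝ≥0∞) ^ 2 * h * momentBoundSq ν μ N m := by
  have hcg := continuous_greenBound ν N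
  have hcm := continuous_momentBound ν N m
  have h1 (p : Fin (m + 1) → Torus) : ENNReal.ofReal (momentBound ν N (m + 1) p) ^ 2
      ≤ ((m + 1 : ℕ) : ℝ≥0∞) * ∑ i : Fin (m + 1), ENNReal.ofReal (greenBound ν N (∑ j, p j)) ^ 2
        * ENNReal.ofReal (momentBound ν N m (fun j => p (i.succAbove j))) ^ 2 := by
    have : momentBound ν N (m + 1) p ^ 2
        ≤ ((m + 1 : ℕ) : ℝ) * ∑ i : Fin (m + 1), greenBound ν N (∑ j, p j) ^ 2
          * momentBound ν N m (fun j => p (i.succAbove j)) ^ 2 := by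
      refine (pow_le_pow_left₀ (momentBound_nonneg ν _ _ _) (momentBound_succ_le ν N m p) 2).trans ?_
      rw [mul_pow, ← Finset.mul_sum, mul_left_comm]
      gcongr
      refine sq_sum_le_card_mul_sum_sq.trans ?_
      simp
    rw [← ENNReal.ofReal_pow (momentBound_nonneg ν _ _ _)]
    refine (ENNReal.ofReal_le_ofReal this).trans (le_of_eq ?_)
    rw [ENNReal.ofReal_mul (by positivity), ENNReal.ofReal_natCast, ENNReal.ofReal_sum_of_nonneg
      fun i _ => by positivity]
    congr 1
    refine Finset.sum_congr rfl fun i _ => ?_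
    rw [ENNReal.ofReal_mul (by positivity), ENNReal.ofReal_pow (greenBound_nonneg ν _ _),
      ENNReal.ofReal_pow (momentBound_nonneg ν _ _ _)]
  have h2 (i : Fin (m + 1)) : ∫⁻ p, ENNReal.ofReal (greenBound ν N (∑ j, p j)) ^ 2
        * ENNReal.ofReal (momentBound ν N m (fun j => p (i.succAbove j))) ^ 2
          ∂(Measure.pi fun _ : Fin (m + 1) => μ) ≤ h * momentBoundSq ν μ N m := by
    have hmp := measurePreserving_piFinSuccAbove (fun _ : Fin (m + 1) => μ) i
    have h3 := hmp.lintegral_comp_emb (MeasurableEquiv.measurableEmbedding _)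
      (fun z : Torus × (Fin m → Torus) => ENNReal.ofReal (greenBound ν N (z.1 + ∑ j, z.2 j)) ^ 2
            * ENNReal.ofReal (momentBound ν N m z.2) ^ 2)
    rw [lintegral_prod_symm' _ (by fun_prop)] at h3
    simp_rw [Fin.sum_univ_succAbove _ i]
    refine (le_of_eq h3).trans ?_
    rw [momentBoundSq, ← lintegral_const_mul _ (by fun_prop)]
    refine lintegral_mono fun z => ?_
    dsimp only
    rw [lintegral_mul_const _ (by fun_prop)]
    gcongr
    exact hh _
  calc momentBoundSq ν μ N (m + 1) ≤ _ := lintegral_mono h1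
    _ = ((m + 1 : ℕ) : ℝ≥0∞) * ∑ i : Fin (m + 1),
          ∫⁻ p, ENNReal.ofReal (greenBound ν N (∑ j, p j)) ^ 2
        * ENNReal.ofReal (momentBound ν N m (fun j => p (i.succAbove j))) ^ 2
          ∂(Measure.pi fun _ : Fin (m + 1) => μ) := by
        rw [lintegral_const_mul _ (by fun_prop), lintegral_finsetSum _ fun i _ => by fun_prop]
    _ ≤ ((m + 1 : ℕ) : ℝ≥0∞) * ∑ i : Fin (m + 1), h * momentBoundSq ν μ N m := by
        gcongr with i; exact h2 i
    _ = _ := by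
        rw [Finset.sum_const, Finset.card_univ, Fintype.card_fin, nsmul_eq_mul]; ring

lemma momentBoundSq_le [IsProbabilityMeasure ν] [IsFiniteMeasure μ] {N : ℕ} {h : ℝ≥0∞}
    (hh : ∀ a, ∫⁻ p, ENNReal.ofReal (greenBound ν N (p + a)) ^ 2 ∂μ ≤ h) (m : ℕ) :
    momentBoundSq ν μ N m ≤ (m.factorial : ℝ≥0∞) ^ 2 * h ^ m := by
  induction m with
  | zero => simp [momentBoundSq_zero]
  | succ m ih =>
    refine (momentBoundSq_succ_le ν μ hh m).trans ?_
    calc _ ≤ ((m + 1 : ℕ) : ℝ≥0∞) ^ 2 * h * ((m.factorial : ℝ≥0∞) ^ 2 * h ^ m) := by gcongr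
      _ = _ := by rw [Nat.factorial_succ]; push_cast; ring

/-- The last frequency to be removed is integrated without a shift. That integral can exploit a
measure with little mass near the origin, which is the source of all smallness later. -/
lemma momentBoundSq_two_le [IsProbabilityMeasure ν] [IsFiniteMeasure μ] {N : ℕ} {h : ℝ≥0∞}
    (hh : ∀ a, ∫⁻ p, ENNReal.ofReal (greenBound ν N (p + a)) ^ 2 ∂μ ≤ h) :
    momentBoundSq ν μ N 2 ≤ 4 * h * ∫⁻ p, ENNReal.ofReal (greenBound ν N p) ^ 2 ∂μ := by
  refine (momentBoundSq_succ_le ν μ hh 1).trans ?_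
  have : momentBoundSq ν μ N 1 ≤ ∫⁻ p, ENNReal.ofReal (greenBound ν N p) ^ 2 ∂μ := by
    have hmp := measurePreserving_funUnique μ (Fin 1)
    rw [← hmp.lintegral_comp_emb (MeasurableEquiv.measurableEmbedding _)]
    refine lintegral_mono fun p => ?_
    have := momentBound_succ_le ν N 0 p
    simp only [momentBound_zero] at this
    gcongr
    simpa using this
  calc _ ≤ ((1 + 1 : ℕ) : ℝ≥0∞) ^ 2 * h * ∫⁻ p, ENNReal.ofReal (greenBound ν N p) ^ 2 ∂μ := by
        gcongr
    _ = _ := by norm_num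

end MomentBound

/-! ### Submultiplicativity in the number of steps -/

section WalkTransform

variable (ν : Measure Lattice)

/-- The Fourier transform `∑ E[e(q·S(N)) ∏ⱼ e(pⱼ·S(nⱼ))]` of the `|ι|`-fold occupation measure of
the first `N` steps, where the sum extends over all times `nⱼ ∈ {1, …, N}`. -/
def walkTransform {ι : Type*} [Fintype ι] [DecidableEq ι] (N : ℕ) (q : Torus)
    (p : ι → Torus) : ℂ :=
  ∑ n ∈ Fintype.piFinset (fun _ : ι => Finset.Icc 1 N),
    ∏ k ∈ Finset.range N, stepChar ν (q + ∑ j with k < n j, p j)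

@[fun_prop]
lemma continuous_walkTransform [IsFiniteMeasure ν] {X ι : Type*} [TopologicalSpace X] [Fintype ι]
    [DecidableEq ι] (N : ℕ) {f : X → Torus} {g : X → ι → Torus} (hf : Continuous f)
    (hg : Continuous g) : Continuous (fun x => walkTransform ν N (f x) (g x)) := by
  have := continuous_stepChar ν
  unfold walkTransform; fun_prop

lemma norm_walkTransform_zero_le {m : ℕ} {N M : ℕ} [IsProbabilityMeasure ν] (hNM : N ≤ M)
    (p : Fin m → Torus) : ‖walkTransform ν N 0 p‖ ≤ momentBound ν M m p := by
  refine (norm_sum_le _ _).trans ?_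
  simp only [zero_add, norm_prod]
  calc _ ≤ ∑ n ∈ Fintype.piFinset (fun _ : Fin m => Finset.Icc 1 N),
        ∏ k ∈ Finset.range M, ‖stepChar ν (∑ j with k < n j, p j)‖ := by
        refine Finset.sum_le_sum fun n hn => ?_
        obtain ⟨L, rfl⟩ := Nat.exists_eq_add_of_le hNM
        rw [Finset.prod_range_add]
        refine le_of_eq ?_
        symm
        convert mul_one _
        refine Finset.prod_eq_one fun k _ => ?_
        rw [Finset.filter_false_of_mem]
        · simp
        · intro j _
          have := Fintype.mem_piFinset.1 hn j
          rw [Finset.mem_Icc] at this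
          omega
    _ ≤ _ := by
        refine Finset.sum_le_sum_of_subset_of_nonneg ?_ fun _ _ _ => by positivity
        refine Fintype.piFinset_subset _ _ fun _ k hk => ?_
        rw [Finset.mem_Icc] at hk
        rw [Finset.mem_range]; omega

lemma walkTransform_comp_equiv {ι κ : Type*} [Fintype ι] [DecidableEq ι] [Fintype κ]
    [DecidableEq κ] (e : ι ≃ κ) (N : ℕ) (q : Torus) (p : κ → Torus) :
    walkTransform ν N q (fun i => p (e i)) = walkTransform ν N q p := by
  refine Finset.sum_bij' (fun n _ k => n (e.symm k)) (fun n _ i => n (e i)) ?_ ?_ ?_ ?_ ?_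
  · intro n hn
    rw [Fintype.mem_piFinset] at hn ⊢
    exact fun k => hn _
  · intro n hn
    rw [Fintype.mem_piFinset] at hn ⊢
    exact fun k => hn _
  · intro n _; simp
  · intro n _; simp
  · intro n _
    refine Finset.prod_congr rfl fun k _ => ?_
    congr 2
    rw [Finset.sum_filter, Finset.sum_filter, ← e.sum_comp]
    simp

/-- Decomposition of the walk transform at time `N₁`; `I` is the set of the indices whose times
are at most `N₁`. -/
lemma walkTransform_add {ι : Type*} [Fintype ι] [DecidableEq ι] (N₁ N₂ : ℕ) (q : Torus)
    (p : ι → Torus) :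
    walkTransform ν (N₁ + N₂) q p = ∑ I : Finset ι,
      walkTransform ν N₁ (q + ∑ j : {j // ¬ j ∈ I}, p j) (fun j : {j // j ∈ I} => p j)
        * walkTransform ν N₂ q (fun j : {j // ¬ j ∈ I} => p j) := by
  classical
  rw [walkTransform, ← Finset.sum_fiberwise (g := fun n : ι → ℕ => ({j | n j ≤ N₁} : Finset ι))]
  refine Finset.sum_congr rfl fun I _ => ?_
  rw [walkTransform, walkTransform, Finset.sum_mul_sum, ← Finset.sum_product']
  refine Finset.sum_bij' (fun n _ => ((fun j : {j // j ∈ I} => n j),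
      (fun j : {j // ¬ j ∈ I} => n j - N₁)))
    (fun z _ j => if h : j ∈ I then z.1 ⟨j, h⟩ else z.2 ⟨j, h⟩ + N₁) ?_ ?_ ?_ ?_ ?_
  · intro n hn
    simp only [Finset.mem_filter, Fintype.mem_piFinset, Finset.mem_product, Finset.mem_Icc] at hn ⊢
    obtain ⟨hn, rfl⟩ := hn
    refine ⟨fun ⟨j, hj⟩ => ?_, fun ⟨j, hj⟩ => ?_⟩ <;> have := hn j <;> simp at hj ⊢ <;> omega
  · intro z hz
    simp only [Finset.mem_filter, Fintype.mem_piFinset, Finset.mem_product, Finset.mem_Icc] at hz ⊢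
    refine ⟨fun j => ?_, ?_⟩
    · split_ifs with h
      · have := hz.1 ⟨j, h⟩; omega
      · have := hz.2 ⟨j, h⟩; omega
    · ext j
      simp only [Finset.mem_filter, Finset.mem_univ, true_and]
      split_ifs with h
      · have := hz.1 ⟨j, h⟩; simp [h, this.2]
      · have := hz.2 ⟨j, h⟩; simp [h]; omega
  · intro n hn
    simp only [Finset.mem_filter] at hn
    obtain ⟨hn, rfl⟩ := hn
    funext j
    by_cases h : n j ≤ N₁
    · simp [h]
    · simp [h]; omega
  · intro z hz
    ext j
    · simp
    · obtain ⟨j, hj⟩ := j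
      simp [hj]
  · intro n hn
    simp only [Finset.mem_filter] at hn
    obtain ⟨hn, rfl⟩ := hn
    have hsplit (f : ι → Torus) : ∑ j, f j
        = ∑ j : {j // j ∈ ({j | n j ≤ N₁} : Finset ι)}, f j
          + ∑ j : {j // ¬ j ∈ ({j | n j ≤ N₁} : Finset ι)}, f j := by
      rw [← Fintype.sum_subtype_add_sum_subtype (fun j => j ∈ ({j | n j ≤ N₁} : Finset ι)) f]
      congr!
    -- Before time `N₁` the frequencies outside `I` are all active, so they only add to the phase;
    -- after it the frequencies in `I` have expired.
    rw [Finset.prod_range_add]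
    congr 1
    · refine Finset.prod_congr rfl fun k hk => ?_
      rw [Finset.mem_range] at hk
      rw [add_assoc, Finset.sum_filter, Finset.sum_filter, hsplit,
        add_comm (∑ j : {j // j ∈ ({j | n j ≤ N₁} : Finset ι)}, _)]
      congr 3
      refine Finset.sum_congr rfl fun j _ => if_pos ?_
      have := j.2
      simp at this; omega
    · refine Finset.prod_congr rfl fun k hk => ?_
      rw [Finset.sum_filter, Finset.sum_filter, hsplit, Finset.sum_eq_zero, zero_add]
      · congr 2
        refine Finset.sum_congr rfl fun j _ => ?_
        congr 1
        simp only [eq_iff_iff]; omega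
      · refine fun j _ => if_neg ?_
        have := (Finset.mem_filter.1 j.2).2
        omega

variable (μ : Measure Torus)

lemma eLpNorm_two_sq {α E : Type*} [MeasurableSpace α] [NormedAddCommGroup E] (f : α → E)
    (m : Measure α) : eLpNorm f 2 m ^ 2 = ∫⁻ x, ‖f x‖ₑ ^ 2 ∂m := by
  have := eLpNorm_nnreal_pow_eq_lintegral (f := f) (μ := m) (p := 2) two_ne_zero
  simpa using this

/-- The largest `L²(μ^m)` norm of `p ↦ walkTransform ν N q p`. -/
def transformNorm (N m : ℕ) : ℝ≥0∞ :=
  ⨆ q, eLpNorm (fun p : Fin m → Torus => walkTransform ν N q p) 2 (Measure.pi fun _ => μ)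

lemma eLpNorm_walkTransform_le [IsFiniteMeasure μ] [IsFiniteMeasure ν] {ι : Type*} [Fintype ι]
    [DecidableEq ι] (N : ℕ) (q : Torus) :
    eLpNorm (fun p : ι → Torus => walkTransform ν N q p) 2 (Measure.pi fun _ => μ)
      ≤ transformNorm ν μ N (Fintype.card ι) := by
  set e := (Fintype.equivFin ι)
  have hmp := measurePreserving_piCongrLeft (fun _ : Fin (Fintype.card ι) => μ) e
  refine le_trans (le_of_eq ?_) (le_iSup _ q)
  have hc : Continuous (fun p : Fin (Fintype.card ι) → Torus => walkTransform ν N q p) :=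
    by fun_prop
  rw [← eLpNorm_comp_measurePreserving hc.aestronglyMeasurable hmp]
  congr 1
  funext p
  rw [Function.comp_apply, ← walkTransform_comp_equiv ν e]
  congr 1
  funext i
  exact (Equiv.piCongrLeft_apply_apply (fun _ => Torus) e p i).symm

lemma measurePreserving_restrict_prod [IsFiniteMeasure μ] {ι : Type*} [Fintype ι]
    (P : ι → Prop) [DecidablePred P] [Fintype {j // P j}] [Fintype {j // ¬ P j}] :
    MeasurePreserving (MeasurableEquiv.piEquivPiSubtypeProd (fun _ : ι => Torus) P)
      (Measure.pi fun _ => μ)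
      ((Measure.pi fun _ : {j // P j} => μ).prod (Measure.pi fun _ : {j // ¬ P j} => μ)) := by
  convert! measurePreserving_piEquivPiSubtypeProd (fun _ : ι => μ) P

/-- Integrate over the frequencies of the first stretch first. The others enter its transform only
through the phase, which the supremum in `transformNorm` absorbs. -/
lemma eLpNorm_mul_walkTransform_le [IsFiniteMeasure μ] [IsFiniteMeasure ν] {ι : Type*}
    [Fintype ι] (N₁ N₂ : ℕ) (q : Torus) (P : ι → Prop) [DecidablePred P]
    [Fintype {j // P j}] [Fintype {j // ¬ P j}] [DecidableEq {j // P j}]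
    [DecidableEq {j // ¬ P j}] :
    eLpNorm (fun p : ι → Torus =>
      walkTransform ν N₁ (q + ∑ j : {j // ¬ P j}, p j) (fun j : {j // P j} => p j)
        * walkTransform ν N₂ q (fun j : {j // ¬ P j} => p j)) 2 (Measure.pi fun _ => μ)
      ≤ transformNorm ν μ N₁ (Fintype.card {j // P j})
        * transformNorm ν μ N₂ (Fintype.card {j // ¬ P j}) := by
  have h3 := (measurePreserving_restrict_prod μ P).lintegral_comp_emb
    (MeasurableEquiv.measurableEmbedding _)
    (fun z : ({j // P j} → Torus) × ({j // ¬ P j} → Torus) =>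
      ‖walkTransform ν N₁ (q + ∑ j, z.2 j) z.1‖ₑ ^ 2 * ‖walkTransform ν N₂ q z.2‖ₑ ^ 2)
  have : OpensMeasurableSpace (({j // P j} → Torus) × ({j // ¬ P j} → Torus)) :=
    Prod.opensMeasurableSpace
  have hm₁ : Measurable fun z : ({j // P j} → Torus) × ({j // ¬ P j} → Torus) =>
      walkTransform ν N₁ (q + ∑ j, z.2 j) z.1 := Continuous.measurable (by fun_prop)
  have hm₂ : Measurable fun p : {j // ¬ P j} → Torus => walkTransform ν N₂ q p :=
    Continuous.measurable (by fun_prop)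
  rw [lintegral_prod_symm' _ (by fun_prop)] at h3
  rw [← ENNReal.pow_le_pow_left_iff two_ne_zero, eLpNorm_two_sq, mul_pow]
  simp_rw [enorm_mul, mul_pow]
  refine (le_of_eq h3).trans ?_
  have h4 (z : {j // ¬ P j} → Torus) :
      ∫⁻ x, ‖walkTransform ν N₁ (q + ∑ j, z j) x‖ₑ ^ 2 * ‖walkTransform ν N₂ q z‖ₑ ^ 2
        ∂(Measure.pi fun _ : {j // P j} => μ)
      ≤ transformNorm ν μ N₁ (Fintype.card {j // P j}) ^ 2 * ‖walkTransform ν N₂ q z‖ₑ ^ 2 := by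
    have hm : Measurable fun x : {j // P j} → Torus => walkTransform ν N₁ (q + ∑ j, z j) x :=
      Continuous.measurable (by fun_prop)
    rw [lintegral_mul_const _ (by fun_prop), ← eLpNorm_two_sq]
    gcongr
    exact eLpNorm_walkTransform_le ν μ N₁ _
  refine (lintegral_mono h4).trans ?_
  rw [lintegral_const_mul _ (by fun_prop), ← eLpNorm_two_sq]
  gcongr
  exact eLpNorm_walkTransform_le ν μ N₂ _

/-- Triangle inequality in `L²` over the subsets `I`; the bound for each depends only on its
cardinality. -/
lemma transformNorm_add_le [IsFiniteMeasure μ] [IsFiniteMeasure ν] (N₁ N₂ m : ℕ) :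
    transformNorm ν μ (N₁ + N₂) m ≤ ∑ k ∈ Finset.range (m + 1),
      m.choose k • (transformNorm ν μ N₁ k * transformNorm ν μ N₂ (m - k)) := by
  refine iSup_le fun q => ?_
  have h1 := Finset.sum_powerset_apply_card
    (fun k => transformNorm ν μ N₁ k * transformNorm ν μ N₂ (m - k)) (x := (Finset.univ : Finset (Fin m)))
  rw [Finset.card_univ, Fintype.card_fin, Finset.powerset_univ] at h1
  rw [← h1]
  simp_rw [walkTransform_add]
  refine le_trans (le_of_eq ?_) ((eLpNorm_sum_le (μ := Measure.pi fun _ : Fin m => μ) (s := Finset.univ)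
    (f := fun (I : Finset (Fin m)) (p : Fin m → Torus) =>
      walkTransform ν N₁ (q + ∑ j : {j // ¬ j ∈ I}, p j) (fun j : {j // j ∈ I} => p j)
        * walkTransform ν N₂ q (fun j : {j // ¬ j ∈ I} => p j)) ?_ one_le_two).trans
    (Finset.sum_le_sum fun I _ => ?_))
  · congr 1
    funext p
    simp
  · intro I _
    exact Continuous.aestronglyMeasurable (by fun_prop)
  · refine (eLpNorm_mul_walkTransform_le ν μ N₁ N₂ q (· ∈ I)).trans (le_of_eq ?_)
    simp [Fintype.card_subtype_compl]

/-- The exponential generating function of the norms `transformNorm ν μ N m`. -/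
def transformGenFun (θ : ℝ≥0∞) (N : ℕ) : ℝ≥0∞ :=
  ∑' m : ℕ, θ ^ m * (m.factorial : ℝ≥0∞)⁻¹ * transformNorm ν μ N m

/-- A binomial convolution of sequences is a product of exponential generating functions. -/
lemma transformGenFun_add_le [IsFiniteMeasure μ] [IsFiniteMeasure ν] (θ : ℝ≥0∞) (N₁ N₂ : ℕ) :
    transformGenFun ν μ θ (N₁ + N₂) ≤ transformGenFun ν μ θ N₁ * transformGenFun ν μ θ N₂ := by
  unfold transformGenFun
  rw [← ENNReal.tsum_mul_right]
  simp_rw [← ENNReal.tsum_mul_left]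
  rw [← ENNReal.tsum_prod (f := fun k l => θ ^ k * (k.factorial : ℝ≥0∞)⁻¹ * transformNorm ν μ N₁ k
      * (θ ^ l * (l.factorial : ℝ≥0∞)⁻¹ * transformNorm ν μ N₂ l)),
    ← Finset.HasAntidiagonal.sigmaAntidiagonalEquivProd.tsum_eq, ENNReal.tsum_sigma']
  refine ENNReal.tsum_le_tsum fun m => ?_
  rw [tsum_fintype]
  have h1 := Finset.sum_coe_sort (Finset.HasAntidiagonal.antidiagonal m)
    (fun z : ℕ × ℕ => θ ^ z.1 * (z.1.factorial : ℝ≥0∞)⁻¹ * transformNorm ν μ N₁ z.1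
      * (θ ^ z.2 * (z.2.factorial : ℝ≥0∞)⁻¹ * transformNorm ν μ N₂ z.2))
  refine le_trans ?_ (le_of_eq h1.symm)
  rw [Finset.Nat.sum_antidiagonal_eq_sum_range_succ
    (fun k l => θ ^ k * (k.factorial : ℝ≥0∞)⁻¹ * transformNorm ν μ N₁ k
      * (θ ^ l * (l.factorial : ℝ≥0∞)⁻¹ * transformNorm ν μ N₂ l))]
  calc _ ≤ θ ^ m * (m.factorial : ℝ≥0∞)⁻¹ * ∑ k ∈ Finset.range (m + 1),
      m.choose k • (transformNorm ν μ N₁ k * transformNorm ν μ N₂ (m - k)) := by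
        gcongr; exact transformNorm_add_le ν μ N₁ N₂ m
    _ ≤ _ := by
        rw [Finset.mul_sum]
        refine Finset.sum_le_sum fun k hk => le_of_eq ?_
        obtain ⟨l, rfl⟩ := Nat.exists_eq_add_of_le (Nat.lt_succ_iff.1 (Finset.mem_range.1 hk))
        rw [Nat.add_sub_cancel_left, nsmul_eq_mul]
        have h2 : (((k + l).choose k : ℕ) : ℝ≥0∞) * ((k + l).factorial : ℝ≥0∞)⁻¹
            = (k.factorial : ℝ≥0∞)⁻¹ * (l.factorial : ℝ≥0∞)⁻¹ := by
          have h3 := Nat.add_choose_mul_factorial_mul_factorial k l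
          rw [← Nat.choose_symm_add] at h3
          have hk0 : (k.factorial : ℝ≥0∞) ≠ 0 := by exact_mod_cast k.factorial_ne_zero
          have hl0 : (l.factorial : ℝ≥0∞) ≠ 0 := by exact_mod_cast l.factorial_ne_zero
          have hm0 : ((k + l).choose k : ℝ≥0∞) ≠ 0 := by
            exact_mod_cast (Nat.choose_pos (Nat.le_add_right k l)).ne'
          rw [← h3]
          push_cast
          rw [mul_assoc, ENNReal.mul_inv (Or.inl hm0) (Or.inl (ENNReal.natCast_ne_top _)),
            ← mul_assoc, ENNReal.mul_inv_cancel hm0 (ENNReal.natCast_ne_top _), one_mul,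
            ENNReal.mul_inv (Or.inl hk0) (Or.inl (ENNReal.natCast_ne_top _))]
        rw [pow_add]
        calc _ = (((k + l).choose k : ℕ) : ℝ≥0∞) * ((k + l).factorial : ℝ≥0∞)⁻¹
              * (θ ^ k * θ ^ l * transformNorm ν μ N₁ k * transformNorm ν μ N₂ l) := by ring
          _ = _ := by rw [h2]; ring

/-- The steps are cut into at most `M + 1` blocks of length at most `N`; `1 ≤ C` accounts for blocks
that are not needed. -/
lemma transformGenFun_le_pow [IsFiniteMeasure μ] [IsFiniteMeasure ν] {θ C : ℝ≥0∞} {N : ℕ}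
    (hC : 1 ≤ C) (h : ∀ N' ≤ N, transformGenFun ν μ θ N' ≤ C) (M n : ℕ) (hn : n ≤ (M + 1) * N) :
    transformGenFun ν μ θ n ≤ C ^ (M + 1) := by
  induction M generalizing n with
  | zero => simpa using h n (by simpa using hn)
  | succ M ih =>
    rcases le_or_gt n N with h1 | h1
    · exact (h n h1).trans (le_self_pow₀ hC (by omega))
    · obtain ⟨l, rfl⟩ := Nat.exists_eq_add_of_le h1.le
      refine (transformGenFun_add_le ν μ θ N l).trans ?_
      rw [pow_succ']
      gcongr
      · exact h N le_rfl
      · exact ih l (by rw [add_mul] at hn; omega)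

end WalkTransform

/-! ### Moments of integrals of occupation transforms -/

section CrossIntegral

lemma aemeasurable_character {α : Type*} [MeasurableSpace α] {m : Measure α} {f : α → Lattice}
    {g : α → Torus} (hf : AEMeasurable f m) (hg : AEMeasurable g m) :
    AEMeasurable (fun a => character (f a) (g a)) m := by
  have h := measurable_character_prod
  have h1 : (fun a => character (f a) (g a))
    = (fun z : Lattice × Torus => character z.1 z.2) ∘ fun a => (f a, g a) := rfl
  rw [h1]
  generalize (fun z : Lattice × Torus => character z.1 z.2) = F at h ⊢
  exact h.comp_aemeasurable (hf.prodMk hg)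

lemma aestronglyMeasurable_character {α : Type*} [MeasurableSpace α] {m : Measure α}
    {f : α → Lattice} (hf : AEMeasurable f m) (p : Torus) :
    AEStronglyMeasurable (fun a => character (f a) p) m :=
  (aemeasurable_character hf aemeasurable_const).aestronglyMeasurable

/-- The Fourier transform of the occupation measure of the path `S` on `{1, …, N}`. -/
def occupationTransform (S : ℕ → Lattice) (N : ℕ) (p : Torus) : ℂ :=
  ∑ n ∈ Finset.Icc 1 N, character (S n) p

lemma norm_occupationTransform_le (S : ℕ → Lattice) (N : ℕ) (p : Torus) :
    ‖occupationTransform S N p‖ ≤ N := by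
  refine (norm_sum_le _ _).trans ?_
  simp

lemma occupationTransform_neg (S : ℕ → Lattice) (N : ℕ) (p : Torus) :
    occupationTransform S N (-p) = (starRingEnd ℂ) (occupationTransform S N p) := by
  simp [occupationTransform, character_neg_right]

/-- Regrouping by steps: the step `x k` is paired with `q` and with those `p j` whose time exceeds
`k`. -/
lemma prod_character_partialSum {ι : Type*} [Fintype ι] (x : ℕ → Lattice) (N : ℕ) (n : ι → ℕ)
    (hn : ∀ j, n j ≤ N) (q : Torus) (p : ι → Torus) :
    (∏ j, character (∑ k ∈ Finset.range (n j), x k) (p j))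
        * character (∑ k ∈ Finset.range N, x k) q
      = ∏ k ∈ Finset.range N, character (x k) (q + ∑ j with k < n j, p j) := by
  simp_rw [character_add_right, character_sum_right, character_sum_left, Finset.prod_mul_distrib,
    Finset.prod_filter]
  rw [mul_comm, Finset.prod_comm]
  congr 1
  refine Finset.prod_congr rfl fun j _ => ?_
  rw [← Finset.prod_filter]
  refine Finset.prod_congr ?_ fun _ _ => rfl
  ext k
  have := hn j
  simp; omega

lemma prod_occupationTransform_mul {ι : Type*} [Fintype ι] [DecidableEq ι] (x : ℕ → Lattice)
    (N : ℕ) (q : Torus) (p : ι → Torus) :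
    (∏ j, occupationTransform (fun n => ∑ k ∈ Finset.range n, x k) N (p j))
        * character (∑ k ∈ Finset.range N, x k) q
      = ∑ n ∈ Fintype.piFinset (fun _ : ι => Finset.Icc 1 N),
        ∏ k ∈ Finset.range N, character (x k) (q + ∑ j with k < n j, p j) := by
  simp only [occupationTransform]
  rw [Finset.prod_univ_sum, Finset.sum_mul]
  refine Finset.sum_congr rfl fun n hn => ?_
  rw [Fintype.mem_piFinset] at hn
  exact prod_character_partialSum x N n (fun j => (Finset.mem_Icc.1 (hn j)).2) q p

section Walk

variable {Ω : Type*} [MeasurableSpace Ω] {P : Measure Ω} [IsProbabilityMeasure P]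
  {ν : Measure Lattice} {X : Fin 2 → ℕ → Ω → Lattice}

lemma integral_prod_character (hlaw : ∀ i k, HasLaw (X i k) ν P)
    (hindep : iIndepFun (fun q : Fin 2 × ℕ => X q.1 q.2) P) (N : ℕ) (a b : ℕ → Torus) :
    ∫ ω, (∏ k ∈ Finset.range N, character (X 0 k ω) (a k))
        * ∏ k ∈ Finset.range N, character (X 1 k ω) (b k) ∂P
      = (∏ k ∈ Finset.range N, stepChar ν (a k)) * ∏ k ∈ Finset.range N, stepChar ν (b k) := by
  have hinj : Function.Injective (fun q : Fin 2 × Fin N => (q.1, (q.2 : ℕ))) := by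
    rintro ⟨i, k⟩ ⟨j, l⟩ h
    simp only [Prod.mk.injEq] at h
    exact Prod.ext h.1 (Fin.ext h.2)
  have h0 : iIndepFun (fun (q : Fin 2 × Fin N) => X q.1 q.2) P := hindep.precomp hinj
  have hf (q : Fin 2 × Fin N) : AEStronglyMeasurable
      (fun x => character x ((![a, b] : Fin 2 → ℕ → Torus) q.1 q.2)) (P.map (X q.1 q.2)) :=
    (measurable_character_left _).aestronglyMeasurable
  have h1 := h0.integral_fun_prod_comp (𝕜 := ℂ)
    (fun q => (hlaw q.1 q.2).aemeasurable) hf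
  have h2 (i : Fin 2) (k : ℕ) (p : Torus) : ∫ ω, character (X i k ω) p ∂P = stepChar ν p :=
    (hlaw i k).integral_comp (measurable_character_left p).aestronglyMeasurable
  simp only [Fintype.prod_prod_type, Fin.prod_univ_two, h2] at h1
  simpa [Finset.prod_range] using h1

/-- By independence the expectation factors over the two walks. They have the same law, and the
first enters conjugated, so a squared modulus results. -/
lemma integral_occupationTransform (hlaw : ∀ i k, HasLaw (X i k) ν P)
    (hindep : iIndepFun (fun q : Fin 2 × ℕ => X q.1 q.2) P) {ι : Type*} [Fintype ι]
    [DecidableEq ι] (N : ℕ) (q : Torus) (p : ι → Torus) :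
    ∫ ω, (∏ j, (occupationTransform (fun n => walk (X 1) n ω) N (p j)
        * (starRingEnd ℂ) (occupationTransform (fun n => walk (X 0) n ω) N (p j))))
        * (character (walk (X 1) N ω) q * (starRingEnd ℂ) (character (walk (X 0) N ω) q)) ∂P
      = walkTransform ν N q p * (starRingEnd ℂ) (walkTransform ν N q p) := by
  have h1 (ω : Ω) : (∏ j, (occupationTransform (fun n => walk (X 1) n ω) N (p j)
        * (starRingEnd ℂ) (occupationTransform (fun n => walk (X 0) n ω) N (p j))))
        * (character (walk (X 1) N ω) q * (starRingEnd ℂ) (character (walk (X 0) N ω) q))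
      = ∑ n ∈ Fintype.piFinset (fun _ : ι => Finset.Icc 1 N),
        ∑ n' ∈ Fintype.piFinset (fun _ : ι => Finset.Icc 1 N),
        (∏ k ∈ Finset.range N, character (X 0 k ω) (-(q + ∑ j with k < n' j, p j)))
        * ∏ k ∈ Finset.range N, character (X 1 k ω) (q + ∑ j with k < n j, p j) := by
    rw [Finset.prod_mul_distrib, mul_mul_mul_comm, ← map_prod, ← map_mul]
    simp only [walk]
    rw [prod_occupationTransform_mul, prod_occupationTransform_mul, map_sum,
      Finset.sum_mul_sum]
    simp_rw [map_prod, ← character_neg_right]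
    refine Finset.sum_congr rfl fun n _ => Finset.sum_congr rfl fun n' _ => mul_comm _ _
  have hi (a b : ℕ → Torus) : Integrable (fun ω =>
      (∏ k ∈ Finset.range N, character (X 0 k ω) (a k))
        * ∏ k ∈ Finset.range N, character (X 1 k ω) (b k)) P := by
    have hm (i k) (r : Torus) : AEStronglyMeasurable (fun ω => character (X i k ω) r) P :=
      aestronglyMeasurable_character (hlaw i k).aemeasurable r
    refine Integrable.of_bound (AEStronglyMeasurable.mul
      (Finset.aestronglyMeasurable_fun_prod _ fun k _ => hm _ _ _)
      (Finset.aestronglyMeasurable_fun_prod _ fun k _ => hm _ _ _)) 1 (ae_of_all _ fun ω => ?_)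
    simp [norm_prod]
  simp_rw [h1]
  rw [integral_finsetSum _ fun n _ => integrable_finsetSum _ fun n' _ => hi _ _]
  simp_rw [integral_finsetSum _ fun n' _ => hi _ _, integral_prod_character hlaw hindep]
  rw [walkTransform, map_sum, Finset.sum_mul_sum]
  simp_rw [map_prod, ← stepChar_neg]
  refine Finset.sum_congr rfl fun n _ => Finset.sum_congr rfl fun n' _ => mul_comm _ _

/-- The integral over `μ` of the product of the occupation transforms of two paths, with
weight `w`. -/
def crossIntegral (μ : Measure Torus) (w : Torus → ℂ) (S₁ S₂ : ℕ → Lattice) (N : ℕ) : ℂ :=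
  ∫ p, w p * (occupationTransform S₂ N p * (starRingEnd ℂ) (occupationTransform S₁ N p)) ∂μ

variable {μ : Measure Torus} [IsFiniteMeasure μ] {w : Torus → ℂ}

lemma norm_crossIntegral_le (hw : ∀ p, ‖w p‖ ≤ 1) (S₁ S₂ : ℕ → Lattice) (N : ℕ) :
    ‖crossIntegral μ w S₁ S₂ N‖ ≤ (N : ℝ) * N * μ.real Set.univ := by
  refine norm_integral_le_of_norm_le_const (ae_of_all _ fun p => ?_)
  rw [norm_mul, norm_mul, RCLike.norm_conj]
  calc _ ≤ 1 * ((N : ℝ) * N) := by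
        gcongr
        · exact hw p
        · exact norm_occupationTransform_le _ _ _
        · exact norm_occupationTransform_le _ _ _
    _ = _ := one_mul _

lemma aemeasurable_walk (hlaw : ∀ i k, HasLaw (X i k) ν P) (i : Fin 2) (n : ℕ) :
    AEMeasurable (walk (X i) n) P :=
  Finset.aemeasurable_fun_sum _ fun k _ => (hlaw i k).aemeasurable

lemma aestronglyMeasurable_occupationTransform {β : Type*} [MeasurableSpace β] {m : Measure β}
    [SFinite m] (hlaw : ∀ i k, HasLaw (X i k) ν P) (i : Fin 2) (N : ℕ) {g : β → Torus}
    (hg : Measurable g) :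
    AEStronglyMeasurable (fun z : Ω × β => occupationTransform (fun n => walk (X i) n z.1) N (g z.2))
      (P.prod m) := by
  refine Finset.aestronglyMeasurable_fun_sum _ fun n _ => AEMeasurable.aestronglyMeasurable ?_
  exact aemeasurable_character (f := fun z : Ω × β => walk (X i) n z.1)
    ((aemeasurable_walk hlaw i n).comp_quasiMeasurePreserving
      Measure.quasiMeasurePreserving_fst) (hg.comp measurable_snd).aemeasurable

/-- The power is an integral over `m` frequencies, and Fubini moves the expectation inside. The
endpoint phase `q` is kept because block splitting produces it. -/
lemma integral_crossIntegral_pow (hlaw : ∀ i k, HasLaw (X i k) ν P)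
    (hindep : iIndepFun (fun q : Fin 2 × ℕ => X q.1 q.2) P) (hwm : Measurable w)
    (hw : ∀ p, ‖w p‖ ≤ 1) (N m : ℕ) (q : Torus) :
    ∫ ω, crossIntegral μ w (fun n => walk (X 0) n ω) (fun n => walk (X 1) n ω) N ^ m
        * (character (walk (X 1) N ω) q * (starRingEnd ℂ) (character (walk (X 0) N ω) q)) ∂P
      = ∫ p : Fin m → Torus, (∏ j, w (p j))
        * (walkTransform ν N q p * (starRingEnd ℂ) (walkTransform ν N q p))
          ∂(Measure.pi fun _ => μ) := by
  set F : Ω → (Fin m → Torus) → ℂ := fun ω p => (∏ j, w (p j)) *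
    ((∏ j, (occupationTransform (fun n => walk (X 1) n ω) N (p j)
        * (starRingEnd ℂ) (occupationTransform (fun n => walk (X 0) n ω) N (p j))))
        * (character (walk (X 1) N ω) q * (starRingEnd ℂ) (character (walk (X 0) N ω) q))) with hF
  have h1 (ω : Ω) : crossIntegral μ w (fun n => walk (X 0) n ω) (fun n => walk (X 1) n ω) N ^ m
        * (character (walk (X 1) N ω) q * (starRingEnd ℂ) (character (walk (X 0) N ω) q))
      = ∫ p, F ω p ∂(Measure.pi fun _ => μ) := by
    have h2 := integral_fintype_prod_eq_pow (ι := Fin m) (μ := μ) (fun p => w p *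
      (occupationTransform (fun n => walk (X 1) n ω) N p
        * (starRingEnd ℂ) (occupationTransform (fun n => walk (X 0) n ω) N p)))
    rw [Fintype.card_fin] at h2
    rw [crossIntegral, ← h2, ← integral_mul_const]
    refine integral_congr_ae (ae_of_all _ fun p => ?_)
    simp only [hF, Finset.prod_mul_distrib]
    ring
  simp_rw [h1]
  rw [integral_integral_swap]
  · refine integral_congr_ae (ae_of_all _ fun p => ?_)
    simp only [hF]
    rw [integral_const_mul, integral_occupationTransform hlaw hindep]
  · have hchar (i : Fin 2) : AEStronglyMeasurable (fun z : Ω × (Fin m → Torus) =>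
        character (walk (X i) N z.1) q) (P.prod (Measure.pi fun _ => μ)) :=
      aestronglyMeasurable_character (f := fun z : Ω × (Fin m → Torus) => walk (X i) N z.1)
        ((aemeasurable_walk hlaw i N).comp_quasiMeasurePreserving
          Measure.quasiMeasurePreserving_fst) q
    have hocc (i : Fin 2) (j : Fin m) : AEStronglyMeasurable (fun z : Ω × (Fin m → Torus) =>
        occupationTransform (fun n => walk (X i) n z.1) N (z.2 j))
          (P.prod (Measure.pi fun _ => μ)) :=
      aestronglyMeasurable_occupationTransform (m := Measure.pi fun _ : Fin m => μ)
        (g := fun z : Fin m → Torus => z j) hlaw i N (measurable_pi_apply j)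
    have hstar {g : Ω × (Fin m → Torus) → ℂ} (hg : AEStronglyMeasurable g
        (P.prod (Measure.pi fun _ => μ))) : AEStronglyMeasurable (fun z => (starRingEnd ℂ) (g z))
          (P.prod (Measure.pi fun _ => μ)) := hg.star
    refine Integrable.of_bound (C := ((N : ℝ) * N) ^ m) ?_ (ae_of_all _ fun z => ?_)
    · refine AEStronglyMeasurable.mul ?_ (AEStronglyMeasurable.mul ?_ ?_)
      · exact Measurable.aestronglyMeasurable (by fun_prop)
      · exact Finset.aestronglyMeasurable_fun_prod _ fun j _ => (hocc 1 j).mul (hstar (hocc 0 j))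
      · exact (hchar 1).mul (hstar (hchar 0))
    · simp only [Function.uncurry, hF, norm_mul, norm_prod, RCLike.norm_conj, norm_character,
        mul_one]
      rw [← Finset.prod_mul_distrib]
      calc _ ≤ ∏ _j : Fin m, ((N : ℝ) * N) := by
            refine Finset.prod_le_prod (fun j _ => by positivity) fun j _ => ?_
            calc _ ≤ 1 * ((N : ℝ) * N) := by
                  gcongr
                  · exact hw _
                  · exact norm_occupationTransform_le _ _ _
                  · exact norm_occupationTransform_le _ _ _
              _ = _ := one_mul _
        _ = _ := by simp

lemma aestronglyMeasurable_crossIntegral (hlaw : ∀ i k, HasLaw (X i k) ν P) (hwm : Measurable w)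
    (N : ℕ) : AEStronglyMeasurable (fun ω =>
      crossIntegral μ w (fun n => walk (X 0) n ω) (fun n => walk (X 1) n ω) N) P := by
  have h (i : Fin 2) := aestronglyMeasurable_occupationTransform (m := μ) hlaw i N measurable_id
  have h1 : AEStronglyMeasurable (fun z : Ω × Torus => w z.2 *
      (occupationTransform (fun n => walk (X 1) n z.1) N z.2
        * (starRingEnd ℂ) (occupationTransform (fun n => walk (X 0) n z.1) N z.2)))
      (P.prod μ) :=
    AEStronglyMeasurable.mul (hwm.comp measurable_snd).aestronglyMeasurable ((h 1).mul (h 0).star)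
  exact h1.integral_prod_right'

/-- The `L²(μ^m)` norm of the walk transform without phase. -/
def transformNormZero (ν : Measure Lattice) (μ : Measure Torus) (N m : ℕ) : ℝ≥0∞ :=
  eLpNorm (fun p : Fin m → Torus => walkTransform ν N 0 p) 2 (Measure.pi fun _ => μ)

/-- For a real variable `|Z|^{2m} = Z^{2m}`, so the absolute moment is a Fourier integral with a
nonnegative integrand times weights of modulus at most 1, which can be dropped. -/
lemma lintegral_pow_crossIntegral_le (hlaw : ∀ i k, HasLaw (X i k) ν P)
    (hindep : iIndepFun (fun q : Fin 2 × ℕ => X q.1 q.2) P) (hwm : Measurable w)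
    (hw : ∀ p, ‖w p‖ ≤ 1) (N m : ℕ)
    (hreal : ∀ ω, (starRingEnd ℂ)
      (crossIntegral μ w (fun n => walk (X 0) n ω) (fun n => walk (X 1) n ω) N)
      = crossIntegral μ w (fun n => walk (X 0) n ω) (fun n => walk (X 1) n ω) N) :
    ∫⁻ ω, ‖crossIntegral μ w (fun n => walk (X 0) n ω) (fun n => walk (X 1) n ω) N‖ₑ ^ (2 * m) ∂P
      ≤ transformNormZero ν μ N (2 * m) ^ 2 := by
  set Z : Ω → ℂ := fun ω =>
    crossIntegral μ w (fun n => walk (X 0) n ω) (fun n => walk (X 1) n ω) N with hZ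
  have hZm : AEStronglyMeasurable Z P := aestronglyMeasurable_crossIntegral hlaw hwm N
  have h1 (ω : Ω) : Z ω ^ (2 * m) = ((‖Z ω‖ ^ (2 * m) : ℝ) : ℂ) := by
    rw [pow_mul, pow_mul, sq, ← Complex.normSq_eq_norm_sq]
    push_cast
    rw [← Complex.mul_conj, hreal ω]
  have h2 := integral_crossIntegral_pow (μ := μ) hlaw hindep hwm hw N (2 * m) 0
  simp only [character_zero_right, map_one, mul_one] at h2
  have h3 : ∫⁻ ω, ‖Z ω‖ₑ ^ (2 * m) ∂P = ‖∫ ω, Z ω ^ (2 * m) ∂P‖ₑ := by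
    simp_rw [h1]
    rw [integral_complex_ofReal]
    have h4 : Integrable (fun ω => ‖Z ω‖ ^ (2 * m)) P := by
      refine Integrable.of_bound (C := ((N : ℝ) * N * μ.real Set.univ) ^ (2 * m))
        (hZm.norm.pow _) (ae_of_all _ fun ω => ?_)
      rw [norm_pow, norm_norm]
      gcongr
      exact norm_crossIntegral_le hw _ _ N
    have h5 : 0 ≤ ∫ ω, ‖Z ω‖ ^ (2 * m) ∂P := integral_nonneg fun ω => by positivity
    rw [show ‖((∫ ω, ‖Z ω‖ ^ (2 * m) ∂P : ℝ) : ℂ)‖ₑ = ENNReal.ofReal (∫ ω, ‖Z ω‖ ^ (2 * m) ∂P) by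
      rw [← ofReal_norm, Complex.norm_of_nonneg h5],
      ofReal_integral_eq_lintegral_ofReal h4 (ae_of_all _ fun ω => by positivity)]
    refine lintegral_congr fun ω => ?_
    rw [ENNReal.ofReal_pow (norm_nonneg _), ofReal_norm]
  rw [h3]
  simp only [hZ]
  rw [h2, transformNormZero, eLpNorm_two_sq]
  refine (enorm_integral_le_lintegral_enorm _).trans (lintegral_mono fun p => ?_)
  rw [enorm_mul, enorm_mul, RCLike.enorm_conj, ← sq]
  refine mul_le_of_le_one_left' ?_
  rw [← ofReal_norm, norm_prod]
  exact ENNReal.ofReal_le_one.2 (Finset.prod_le_one (fun _ _ => norm_nonneg _) fun j _ => hw _)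

lemma sq_lintegral_mul_le {α : Type*} [MeasurableSpace α] {m : Measure α} {f g : α → ℝ≥0∞}
    (hf : AEMeasurable f m) (hg : AEMeasurable g m) :
    (∫⁻ x, f x * g x ∂m) ^ 2 ≤ (∫⁻ x, f x ^ 2 ∂m) * ∫⁻ x, g x ^ 2 ∂m := by
  have h := ENNReal.lintegral_mul_le_Lp_mul_Lq m Real.HolderConjugate.two_two hf hg
  refine (pow_le_pow_left' h 2).trans (le_of_eq ?_)
  rw [mul_pow, ← ENNReal.rpow_natCast, ← ENNReal.rpow_natCast, ← ENNReal.rpow_mul,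
    ← ENNReal.rpow_mul]
  simp

/-- The squared norm with phase `q` is the expectation of `Z^{m+1}` times a unimodular variable,
hence at most `E |Z|^{m+1}` for the integral `Z` with weight 1. Cauchy–Schwarz on `|Z| · |Z|^m`
leaves even moments without phase, and isolates the second moment, which is small. -/
lemma transformNorm_succ_sq_le [μ.IsNegInvariant] (hlaw : ∀ i k, HasLaw (X i k) ν P)
    (hindep : iIndepFun (fun q : Fin 2 × ℕ => X q.1 q.2) P) (N m : ℕ) :
    transformNorm ν μ N (m + 1) ^ 2
      ≤ transformNormZero ν μ N 2 * transformNormZero ν μ N (2 * m) := by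
  set Z : Ω → ℂ := fun ω =>
    crossIntegral μ (fun _ => 1) (fun n => walk (X 0) n ω) (fun n => walk (X 1) n ω) N with hZ
  -- The reflection `p ↦ -p` preserves `μ` and conjugates the integrand.
  have hreal (ω : Ω) : (starRingEnd ℂ) (Z ω) = Z ω := by
    simp only [hZ, crossIntegral, one_mul]
    rw [← integral_conj, ← integral_neg_eq_self]
    refine integral_congr_ae (ae_of_all _ fun p => ?_)
    simp [occupationTransform_neg]
  have hZm : AEStronglyMeasurable Z P :=
    aestronglyMeasurable_crossIntegral hlaw measurable_const N
  have hmom (l : ℕ) : ∫⁻ ω, ‖Z ω‖ₑ ^ (2 * l) ∂P ≤ transformNormZero ν μ N (2 * l) ^ 2 :=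
    lintegral_pow_crossIntegral_le hlaw hindep measurable_const (by simp) N l hreal
  have h1 : ∫⁻ ω, ‖Z ω‖ₑ ^ (m + 1) ∂P
      ≤ transformNormZero ν μ N 2 * transformNormZero ν μ N (2 * m) := by
    rw [← ENNReal.pow_le_pow_left_iff two_ne_zero, mul_pow]
    simp_rw [pow_succ' _ m]
    refine (sq_lintegral_mul_le hZm.enorm (hZm.enorm.pow_const _)).trans ?_
    simp_rw [← pow_mul, mul_comm m 2]
    exact mul_le_mul' (by simpa using hmom 1) (hmom m)
  have h2 (q : Torus) :
      eLpNorm (fun p : Fin (m + 1) → Torus => walkTransform ν N q p) 2 (Measure.pi fun _ => μ) ^ 2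
        ≤ ∫⁻ ω, ‖Z ω‖ₑ ^ (m + 1) ∂P := by
    have h3 := integral_crossIntegral_pow (μ := μ) (w := fun _ => 1) hlaw hindep measurable_const
      (by simp) N (m + 1) q
    simp only [Finset.prod_const_one, one_mul] at h3
    have h4 : eLpNorm (fun p : Fin (m + 1) → Torus => walkTransform ν N q p) 2
          (Measure.pi fun _ => μ) ^ 2
        = ‖∫ p : Fin (m + 1) → Torus, walkTransform ν N q p
          * (starRingEnd ℂ) (walkTransform ν N q p) ∂(Measure.pi fun _ => μ)‖ₑ := by
      have : IsProbabilityMeasure ν := by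
        rw [← (hlaw 0 0).map_eq]
        exact Measure.isProbabilityMeasure_map (hlaw 0 0).aemeasurable
      have hc : Continuous fun p : Fin (m + 1) → Torus => walkTransform ν N q p := by fun_prop
      have hi : Integrable (fun p : Fin (m + 1) → Torus => ‖walkTransform ν N q p‖ ^ 2)
          (Measure.pi fun _ => μ) := by
        obtain ⟨C, hC⟩ := isCompact_univ.exists_bound_of_continuousOn (hc.norm.pow 2).continuousOn
        exact Integrable.of_bound (hc.norm.pow 2).aestronglyMeasurable C
          (ae_of_all _ fun x => hC x trivial)
      simp_rw [Complex.mul_conj, Complex.normSq_eq_norm_sq]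
      rw [integral_complex_ofReal, eLpNorm_two_sq, ← ofReal_norm,
        Complex.norm_of_nonneg (integral_nonneg fun p => by positivity),
        ofReal_integral_eq_lintegral_ofReal hi (ae_of_all _ fun ω => by positivity)]
      refine lintegral_congr fun ω => ?_
      rw [ENNReal.ofReal_pow (norm_nonneg _), ofReal_norm]
    rw [h4, ← h3]
    refine (enorm_integral_le_lintegral_enorm _).trans (le_of_eq (lintegral_congr fun ω => ?_))
    rw [enorm_mul, enorm_mul, RCLike.enorm_conj, ← ofReal_norm (character _ _),
      ← ofReal_norm (character _ _)]
    simp [hZ, enorm_pow]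
  rw [transformNorm, ENNReal.iSup_pow]
  exact iSup_le fun q => (h2 q).trans h1

end Walk

end CrossIntegral

/-! ### The dominating measure on the torus and the estimate for one block -/

section KernelMeasure

/-- The Fourier series with coefficients `g`. -/
def latticeFourier (g : Lattice → ℝ) (p : Torus) : ℂ :=
  ∑' z, (g z : ℂ) * character (-z) p

lemma norm_coe_mul_character (a : ℝ) (z : Lattice) (p : Torus) :
    ‖(a : ℂ) * character z p‖ = |a| := by
  rw [norm_mul, norm_character, mul_one, Complex.norm_real, Real.norm_eq_abs]

variable {g : Lattice → ℝ}

lemma summable_coe_mul_character (hg : Summable g) (p : Torus) :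
    Summable fun z => (g z : ℂ) * character (-z) p :=
  Summable.of_norm (by simpa only [norm_coe_mul_character] using hg.abs)

lemma continuous_latticeFourier (hg : Summable g) : Continuous (latticeFourier g) :=
  continuous_tsum (fun _ => continuous_const.mul (continuous_character _)) hg.abs
    fun _ _ => (norm_coe_mul_character _ _ _).le

lemma norm_latticeFourier_le (hg : Summable g) (h0 : ∀ z, 0 ≤ g z) (p : Torus) :
    ‖latticeFourier g p‖ ≤ ∑' z, g z := by
  refine tsum_of_norm_bounded hg.hasSum fun z => ?_
  rw [norm_coe_mul_character, abs_of_nonneg (h0 z)]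

lemma integral_latticeFourier_mul (hg : Summable g) {u : Torus → ℂ} (hu : Continuous u) {B : ℝ}
    (hB : ∀ p, ‖u p‖ ≤ B) :
    ∫ p, latticeFourier g p * u p = ∑' z, (g z : ℂ) * ∫ p, character (-z) p * u p := by
  have hc (z : Lattice) : Continuous fun p => (g z : ℂ) * (character (-z) p * u p) :=
    continuous_const.mul ((continuous_character _).mul hu)
  have hb (z : Lattice) (p : Torus) : ‖(g z : ℂ) * (character (-z) p * u p)‖ ≤ |g z| * B := by
    rw [← mul_assoc, norm_mul, norm_coe_mul_character]
    exact mul_le_mul_of_nonneg_left (hB p) (abs_nonneg _)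
  have hi (z : Lattice) : Integrable fun p => (g z : ℂ) * (character (-z) p * u p) :=
    Integrable.of_bound (hc z).aestronglyMeasurable _ (ae_of_all _ (hb z))
  have hs : Summable fun z => ∫ p, ‖(g z : ℂ) * (character (-z) p * u p)‖ := by
    refine Summable.of_nonneg_of_le (fun z => integral_nonneg fun p => norm_nonneg _)
      (fun z => ?_) (hg.abs.mul_right B)
    refine (integral_mono (hi z).norm (integrable_const _) (hb z)).trans ?_
    simp
  have h1 := integral_tsum_of_summable_integral_norm hi hs
  simp_rw [integral_const_mul] at h1
  rw [h1]
  refine integral_congr_ae (ae_of_all _ fun p => ?_)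
  simp only [latticeFourier, ← tsum_mul_right, mul_assoc]

lemma integral_latticeFourier_mul_character (hg : Summable g) (y : Lattice) :
    ∫ p, latticeFourier g p * character y p = g y := by
  rw [integral_latticeFourier_mul hg (continuous_character y) fun p => (norm_character y p).le]
  simp_rw [← character_add_left, integral_character]
  rw [tsum_eq_single y]
  · simp
  · intro z hz
    rw [if_neg (by rwa [neg_add_eq_zero]), mul_zero]

lemma integral_latticeFourier_sq_mul_character (hg : Summable g) (h0 : ∀ z, 0 ≤ g z)
    (x : Lattice) :
    ∫ p, latticeFourier g p ^ 2 * character x p = ((∑' z, g z * g (x - z) : ℝ) : ℂ) := by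
  have hu : Continuous fun p => latticeFourier g p * character x p :=
    (continuous_latticeFourier hg).mul (continuous_character x)
  have h1 := integral_latticeFourier_mul hg hu (B := ∑' z, g z) fun p => by
    rw [norm_mul, norm_character, mul_one]; exact norm_latticeFourier_le hg h0 p
  simp_rw [sq, mul_assoc]
  rw [h1, Complex.ofReal_tsum]
  refine tsum_congr fun z => ?_
  push_cast
  rw [← integral_latticeFourier_mul_character hg (x - z)]
  congr 1
  refine integral_congr_ae (ae_of_all _ fun p => ?_)
  simp only [sub_eq_add_neg, character_add_left]
  ring

/-- With `h` the Fourier series and `|h| ≤ 2`, the constant is `5 = 1 + 2²`. The other bound factors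
`1 - h² = (1 + h)(1 - h)`, where `|1 + h| ≤ 3` and `h` is compared with its value `∑ g` at the
origin through the first moment of `g`. -/
lemma norm_one_sub_latticeFourier_sq_le (hg : Summable g) (h0 : ∀ z, 0 ≤ g z)
    (hs : ∑' z, g z ≤ 2) (hg1 : Summable fun z => g z * ‖toPlane z‖) (p : Torus) :
    ‖1 - latticeFourier g p ^ 2‖ ≤ min 5 (3 * |1 - ∑' z, g z|
      + 6 * Real.pi * (∑' z, g z * ‖toPlane z‖) * torusDist p) := by
  set s := ∑' z, g z with hs_def
  have hh := norm_latticeFourier_le hg h0 p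
  refine le_min ?_ ?_
  · refine (norm_sub_le _ _).trans ?_
    rw [norm_one, norm_pow]
    nlinarith [norm_nonneg (latticeFourier g p)]
  · have h1 : ‖(s : ℂ) - latticeFourier g p‖
        ≤ 2 * Real.pi * (∑' z, g z * ‖toPlane z‖) * torusDist p := by
      have h2 : (s : ℂ) - latticeFourier g p
          = ∑' z, ((g z : ℂ) - (g z : ℂ) * character (-z) p) := by
        rw [hs_def, Complex.ofReal_tsum, latticeFourier,
          (Complex.hasSum_ofReal.2 hg.hasSum).summable.tsum_sub (summable_coe_mul_character hg p)]
      rw [h2]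
      have h3 := hg1.hasSum.mul_left (2 * Real.pi * torusDist p)
      refine (tsum_of_norm_bounded h3 fun z => ?_).trans (le_of_eq (by ring))
      have h4 := norm_character_sub_one_le (-z) p
      have h5 : ‖toPlane (-z)‖ = ‖toPlane z‖ := by
        rw [← sq_eq_sq₀ (norm_nonneg _) (norm_nonneg _), norm_toPlane_sq, norm_toPlane_sq]
        simp
      rw [h5] at h4
      rw [← mul_one_sub, norm_mul, Complex.norm_real, Real.norm_of_nonneg (h0 z), norm_sub_rev]
      calc _ ≤ g z * (2 * Real.pi * (‖toPlane z‖ * torusDist p)) :=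
            mul_le_mul_of_nonneg_left h4 (h0 z)
        _ = _ := by ring
    have h6 : ‖1 - latticeFourier g p‖
        ≤ |1 - s| + 2 * Real.pi * (∑' z, g z * ‖toPlane z‖) * torusDist p := by
      have : 1 - latticeFourier g p = ((1 - s : ℝ) : ℂ) + ((s : ℂ) - latticeFourier g p) := by
        push_cast; ring
      rw [this]
      refine (norm_add_le _ _).trans (add_le_add ?_ h1)
      rw [Complex.norm_real, Real.norm_eq_abs]
    have h7 : ‖1 + latticeFourier g p‖ ≤ 3 := by
      refine (norm_add_le _ _).trans ?_
      rw [norm_one]; linarith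
    calc ‖1 - latticeFourier g p ^ 2‖
        = ‖1 + latticeFourier g p‖ * ‖1 - latticeFourier g p‖ := by
          rw [← norm_mul]; congr 1; ring
      _ ≤ 3 * (|1 - s| + 2 * Real.pi * (∑' z, g z * ‖toPlane z‖) * torusDist p) := by gcongr
      _ = _ := by ring

/-- The density `min 5 (α + β D(p))`. -/
def kernelWeight (α β : ℝ) (p : Torus) : ℝ := min 5 (α + β * torusDist p)

lemma continuous_kernelWeight (α β : ℝ) : Continuous (kernelWeight α β) := by
  have := continuous_torusDist
  unfold kernelWeight; fun_prop

/-- The measure on the torus with density `min 5 (α + β D(p))`. -/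
def kernelMeasure (α β : ℝ) : Measure Torus :=
  volume.withDensity fun p => ENNReal.ofReal (kernelWeight α β p)

lemma measurable_ofReal_kernelWeight (α β : ℝ) :
    Measurable fun p => ENNReal.ofReal (kernelWeight α β p) :=
  (continuous_kernelWeight α β).measurable.ennreal_ofReal

lemma lintegral_kernelMeasure (α β : ℝ) {F : Torus → ℝ≥0∞} (hF : Measurable F) :
    ∫⁻ p, F p ∂(kernelMeasure α β) = ∫⁻ p, ENNReal.ofReal (kernelWeight α β p) * F p :=
  lintegral_withDensity_eq_lintegral_mul _ (measurable_ofReal_kernelWeight α β) hF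

lemma lintegral_kernelMeasure_le (α β : ℝ) {F : Torus → ℝ≥0∞} (hF : Measurable F) :
    ∫⁻ p, F p ∂(kernelMeasure α β) ≤ 5 * ∫⁻ p, F p := by
  rw [lintegral_kernelMeasure α β hF, ← lintegral_const_mul _ hF]
  refine lintegral_mono fun p => ?_
  gcongr
  exact (ENNReal.ofReal_le_ofReal (min_le_left _ _)).trans (by norm_num)

instance (α β : ℝ) : IsFiniteMeasure (kernelMeasure α β) := by
  refine ⟨?_⟩
  have := lintegral_kernelMeasure_le α β (F := fun _ => 1) measurable_const
  simp only [lintegral_one, measure_univ] at this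
  exact this.trans_lt (by norm_num)

instance : (volume : Measure UnitAddCircle).IsNegInvariant := inferInstance

instance (α β : ℝ) : (kernelMeasure α β).IsNegInvariant := by
  refine ⟨Measure.ext fun s hs => ?_⟩
  rw [Measure.neg, Measure.map_apply measurable_neg hs, kernelMeasure,
    withDensity_apply _ (measurable_neg hs), withDensity_apply _ hs,
    ← lintegral_indicator hs, ← lintegral_indicator (measurable_neg hs),
    ← lintegral_neg_eq_self (μ := (volume : Measure Torus))
      (s.indicator fun p => ENNReal.ofReal (kernelWeight α β p))]
  refine lintegral_congr fun p => ?_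
  simp only [Set.indicator, kernelWeight, torusDist_neg]
  rfl

variable {ν : Measure Lattice} [IsProbabilityMeasure ν]

lemma lintegral_ofReal_greenBound_sq (N : ℕ) :
    ∫⁻ p, ENNReal.ofReal (greenBound ν N p) ^ 2 = ENNReal.ofReal (∫ p, greenBound ν N p ^ 2) := by
  have hc := continuous_greenBound ν N
  rw [ofReal_integral_eq_lintegral_ofReal (integrable_of_continuous_torus (by fun_prop))
    (ae_of_all _ fun p => by positivity)]
  refine lintegral_congr fun p => ?_
  rw [ENNReal.ofReal_pow (greenBound_nonneg ν N p)]

/-- Only the crude density bound 5 survives an arbitrary shift; translation invariance of Haar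
measure then removes the shift. -/
lemma lintegral_greenBound_add_kernelMeasure_le {C : ℝ} {N : ℕ}
    (hC : ∫ p, greenBound ν N p ^ 2 ≤ C * N) (α β : ℝ) (a : Torus) :
    ∫⁻ p, ENNReal.ofReal (greenBound ν N (p + a)) ^ 2 ∂(kernelMeasure α β)
      ≤ ENNReal.ofReal (5 * C * N) := by
  have hc := continuous_greenBound ν N
  refine (lintegral_kernelMeasure_le α β (by fun_prop)).trans ?_
  rw [lintegral_add_right_eq_self (fun p => ENNReal.ofReal (greenBound ν N p) ^ 2) a,
    lintegral_ofReal_greenBound_sq, mul_assoc, ENNReal.ofReal_mul (by norm_num)]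
  gcongr
  norm_num

lemma lintegral_greenBound_kernelMeasure_le {C C' α β : ℝ} {N : ℕ} (hα : 0 ≤ α) (hβ : 0 ≤ β)
    (hC : ∫ p, greenBound ν N p ^ 2 ≤ C * N)
    (hC' : ∫ p, torusDist p * greenBound ν N p ^ 2 ≤ C' * √N) :
    ∫⁻ p, ENNReal.ofReal (greenBound ν N p) ^ 2 ∂(kernelMeasure α β)
      ≤ ENNReal.ofReal (α * (C * N) + β * (C' * √N)) := by
  have hc := continuous_greenBound ν N
  have hd := continuous_torusDist
  rw [lintegral_kernelMeasure α β (by fun_prop)]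
  calc _ ≤ ∫⁻ p, ENNReal.ofReal
        (α * greenBound ν N p ^ 2 + β * (torusDist p * greenBound ν N p ^ 2)) := by
        refine lintegral_mono fun p => ?_
        dsimp only
        rw [← ENNReal.ofReal_pow (greenBound_nonneg ν N p),
          ← ENNReal.ofReal_mul' (sq_nonneg _)]
        apply ENNReal.ofReal_le_ofReal
        have : kernelWeight α β p ≤ α + β * torusDist p := min_le_right _ _
        nlinarith [sq_nonneg (greenBound ν N p)]
    _ = ENNReal.ofReal (∫ p,
        (α * greenBound ν N p ^ 2 + β * (torusDist p * greenBound ν N p ^ 2))) := by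
        rw [ofReal_integral_eq_lintegral_ofReal (integrable_of_continuous_torus (by fun_prop))
          (ae_of_all _ fun p => ?_)]
        have := torusDist_nonneg p
        positivity
    _ ≤ _ := by
        apply ENNReal.ofReal_le_ofReal
        rw [integral_add (integrable_of_continuous_torus (by fun_prop))
          (integrable_of_continuous_torus (by fun_prop)), integral_const_mul, integral_const_mul]
        gcongr

lemma transformNormZero_sq_le_momentBoundSq (μ : Measure Torus) {N' N : ℕ} (hN : N' ≤ N) (m : ℕ) :
    transformNormZero ν μ N' m ^ 2 ≤ momentBoundSq ν μ N m := by
  rw [transformNormZero, eLpNorm_two_sq]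
  refine lintegral_mono fun p => ?_
  gcongr
  rw [← ofReal_norm]
  exact ENNReal.ofReal_le_ofReal (norm_walkTransform_zero_le ν hN p)

lemma transformNorm_zero_le (μ : Measure Torus) [IsFiniteMeasure μ] (N : ℕ) :
    transformNorm ν μ N 0 ≤ 1 := by
  refine iSup_le fun q => ?_
  refine (eLpNorm_le_of_ae_bound (C := 1) (ae_of_all _ fun p => ?_)).trans ?_
  · simp only [walkTransform]
    refine (norm_sum_le _ _).trans ?_
    simp only [norm_prod]
    simp
    exact pow_le_one₀ (norm_nonneg _) (norm_stepChar_le_one ν q)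
  · simp

lemma factorial_two_mul_le (m : ℕ) : (2 * m).factorial ≤ 4 ^ m * m.factorial ^ 2 := by
  have h1 := Nat.choose_mul_factorial_mul_factorial (n := 2 * m) (k := m) (by omega)
  have h2 : (2 * m).choose m ≤ 4 ^ m := by
    calc _ ≤ 2 ^ (2 * m) := Nat.choose_le_two_pow _ _
      _ = _ := by rw [pow_mul]; norm_num
  rw [← h1, two_mul, Nat.add_sub_cancel, mul_assoc, ← sq, ← two_mul]
  gcongr

section Walk

variable {Ω : Type*} [MeasurableSpace Ω] {P : Measure Ω} [IsProbabilityMeasure P]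
  {X : Fin 2 → ℕ → Ω → Lattice}

/-- `hsmall` bounds the order-two norm by `η² N`, and the order-`2m` norm is at most `(2m)!
(5CN)^m`. The inequality `(2m)! ≤ 4^m (m!)²` turns 5 into 20, and the spare factor `N` is absorbed
by `20CN`. -/
lemma transformNorm_succ_kernelMeasure_le (hlaw : ∀ i k, HasLaw (X i k) ν P)
    (hindep : iIndepFun (fun q : Fin 2 × ℕ => X q.1 q.2) P) {C C' α β η : ℝ} {N : ℕ}
    (hC1 : 1 ≤ C) (hα : 0 ≤ α) (hβ : 0 ≤ β) (hη : 0 ≤ η)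
    (hC : ∫ p, greenBound ν N p ^ 2 ≤ C * N)
    (hC' : ∫ p, torusDist p * greenBound ν N p ^ 2 ≤ C' * √N)
    (hsmall : 20 * C * N * (α * (C * N) + β * (C' * √N)) ≤ (η ^ 2 * N) ^ 2) {N' : ℕ}
    (hN' : N' ≤ N) (m : ℕ) :
    transformNorm ν (kernelMeasure α β) N' (m + 1)
      ≤ ENNReal.ofReal (η * (m + 1).factorial * √(20 * C * N) ^ (m + 1)) := by
  have hh := lintegral_greenBound_add_kernelMeasure_le (ν := ν) hC α β
  have h2 : transformNormZero ν (kernelMeasure α β) N' 2 ≤ ENNReal.ofReal (η ^ 2 * N) := by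
    rw [← ENNReal.pow_le_pow_left_iff two_ne_zero]
    refine (transformNormZero_sq_le_momentBoundSq _ hN' 2).trans ?_
    refine (momentBoundSq_two_le ν _ hh).trans ?_
    calc _ ≤ 4 * ENNReal.ofReal (5 * C * N)
          * ENNReal.ofReal (α * (C * N) + β * (C' * √N)) := by
          gcongr; exact lintegral_greenBound_kernelMeasure_le hα hβ hC hC'
      _ = ENNReal.ofReal (20 * C * N * (α * (C * N) + β * (C' * √N))) := by
          rw [← ENNReal.ofReal_ofNat 4, ← ENNReal.ofReal_mul (by norm_num),
            ← ENNReal.ofReal_mul (by positivity)]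
          congr 1; ring
      _ ≤ _ := by
          rw [← ENNReal.ofReal_pow (by positivity)]
          exact ENNReal.ofReal_le_ofReal hsmall
  have h3 : transformNormZero ν (kernelMeasure α β) N' (2 * m)
      ≤ ENNReal.ofReal ((2 * m).factorial * (5 * C * N) ^ m) := by
    rw [← ENNReal.pow_le_pow_left_iff two_ne_zero]
    refine (transformNormZero_sq_le_momentBoundSq _ hN' _).trans ?_
    refine (momentBoundSq_le ν _ hh _).trans (le_of_eq ?_)
    rw [← ENNReal.ofReal_natCast, ← ENNReal.ofReal_pow (by positivity),
      ← ENNReal.ofReal_pow (by positivity), ← ENNReal.ofReal_pow (by positivity),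
      ← ENNReal.ofReal_mul (by positivity)]
    congr 1; ring
  rw [← ENNReal.pow_le_pow_left_iff two_ne_zero]
  refine (transformNorm_succ_sq_le hlaw hindep N' m).trans ?_
  refine (mul_le_mul' h2 h3).trans ?_
  rw [← ENNReal.ofReal_mul (by positivity), ← ENNReal.ofReal_pow (by positivity)]
  apply ENNReal.ofReal_le_ofReal
  have h6 : (√(20 * C * N) ^ (m + 1)) ^ 2 = (20 * C * N) ^ (m + 1) := by
    rw [pow_right_comm, Real.sq_sqrt (by positivity)]
  rw [mul_pow (η * _), h6, mul_pow η]
  have h4 : ((2 * m).factorial : ℝ) ≤ 4 ^ m * (m.factorial : ℝ) ^ 2 := by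
    exact_mod_cast factorial_two_mul_le m
  have h5 : (m.factorial : ℝ) ≤ (m + 1).factorial := by
    exact_mod_cast Nat.factorial_le (Nat.le_succ m)
  calc _ ≤ η ^ 2 * N * ((4 ^ m * ((m + 1).factorial : ℝ) ^ 2) * (5 * C * N) ^ m) := by
        gcongr
        exact h4.trans (by gcongr)
    _ = η ^ 2 * ((m + 1).factorial : ℝ) ^ 2 * ((20 * C * N) ^ m * N) := by
        rw [show (20 * C * N : ℝ) = 4 * (5 * C * N) by ring, mul_pow 4]; ring
    _ ≤ η ^ 2 * ((m + 1).factorial : ℝ) ^ 2 * ((20 * C * N) ^ m * (20 * C * N)) := by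
        gcongr
        nlinarith [(Nat.cast_nonneg N : (0 : ℝ) ≤ N)]
    _ = _ := by ring

lemma transformGenFun_kernelMeasure_le (hlaw : ∀ i k, HasLaw (X i k) ν P)
    (hindep : iIndepFun (fun q : Fin 2 × ℕ => X q.1 q.2) P) {C C' α β η θ : ℝ} {N : ℕ}
    (hC1 : 1 ≤ C) (hα : 0 ≤ α) (hβ : 0 ≤ β) (hη : 0 ≤ η) (hθ : 0 ≤ θ)
    (hC : ∫ p, greenBound ν N p ^ 2 ≤ C * N)
    (hC' : ∫ p, torusDist p * greenBound ν N p ^ 2 ≤ C' * √N)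
    (hsmall : 20 * C * N * (α * (C * N) + β * (C' * √N)) ≤ (η ^ 2 * N) ^ 2)
    (hθN : θ * √(20 * C * N) ≤ 1 / 2) {N' : ℕ} (hN' : N' ≤ N) :
    transformGenFun ν (kernelMeasure α β) (ENNReal.ofReal θ) N' ≤ ENNReal.ofReal (1 + η) := by
  -- The term of order zero is at most 1; the others are at most `η 2^{-(m+1)}` and add up to at
  -- most `η`.
  rw [transformGenFun, tsum_eq_zero_add' ENNReal.summable, ENNReal.ofReal_add zero_le_one hη,
    ENNReal.ofReal_one]
  refine add_le_add (by simpa using transformNorm_zero_le _ N') ?_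
  have h1 (m : ℕ) : ENNReal.ofReal θ ^ (m + 1) * ((m + 1).factorial : ℝ≥0∞)⁻¹
      * transformNorm ν (kernelMeasure α β) N' (m + 1)
      ≤ ENNReal.ofReal η * ENNReal.ofReal ((1 / 2) ^ (m + 1)) := by
    have hf : (0 : ℝ) < (m + 1).factorial := by exact_mod_cast Nat.factorial_pos _
    calc _ ≤ ENNReal.ofReal θ ^ (m + 1) * ((m + 1).factorial : ℝ≥0∞)⁻¹
          * ENNReal.ofReal (η * (m + 1).factorial * √(20 * C * N) ^ (m + 1)) := by
          gcongr
          exact transformNorm_succ_kernelMeasure_le hlaw hindep hC1 hα hβ hη hC hC' hsmall hN' m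
      _ = ENNReal.ofReal (η * (θ * √(20 * C * N)) ^ (m + 1)) := by
          rw [← ENNReal.ofReal_natCast, ← ENNReal.ofReal_inv_of_pos hf,
            ← ENNReal.ofReal_pow hθ, ← ENNReal.ofReal_mul (by positivity),
            ← ENNReal.ofReal_mul (by positivity)]
          congr 1
          rw [mul_pow]
          field_simp
      _ ≤ _ := by
          rw [← ENNReal.ofReal_mul hη]
          apply ENNReal.ofReal_le_ofReal
          gcongr
  refine (ENNReal.tsum_le_tsum h1).trans ?_
  rw [ENNReal.tsum_mul_left]
  refine mul_le_of_le_one_right' ?_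
  have h2 : HasSum (fun m : ℕ => ((1 / 2 : ℝ)) ^ (m + 1)) 1 := by
    have := hasSum_geometric_two.mul_left (1 / 2 : ℝ)
    simp_rw [pow_succ']
    simpa using this
  rw [← ENNReal.ofReal_tsum_of_nonneg (fun m => by positivity) h2.summable, h2.tsum_eq,
    ENNReal.ofReal_one]

end Walk

end KernelMeasure

/-! ### Lattice sums of the rescaled density as Riemann sums -/

section Rescale

/-- The integer part of `r x`. -/
def latticeFloor (r : ℝ) (x : Plane) : Lattice := fun i => ⌊r * x i⌋

lemma measurable_latticeFloor (r : ℝ) : Measurable (latticeFloor r) := by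
  unfold latticeFloor
  fun_prop

/-- Each lattice point is the image of a square of side `1/r`. A lattice sum with weight `r⁻²` thus
becomes the integral of a step function on the plane, to which dominated convergence applies. -/
lemma map_latticeFloor {r : ℝ} (hr : 0 < r) :
    Measure.map (latticeFloor r) volume = ENNReal.ofReal ((r ^ 2)⁻¹) • Measure.count := by
  refine Measure.ext_of_singleton fun z => ?_
  rw [Measure.map_apply (measurable_latticeFloor r) (measurableSet_singleton z),
    Measure.smul_apply, Measure.count_singleton, smul_eq_mul, mul_one]
  have h1 : latticeFloor r ⁻¹' {z} = (WithLp.ofLp : Plane → (Fin 2 → ℝ)) ⁻¹'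
      (Set.univ.pi fun i => Set.Ico ((z i : ℝ) / r) (((z i : ℝ) + 1) / r)) := by
    ext x
    simp only [Set.mem_preimage, Set.mem_singleton_iff, Set.mem_univ_pi, Set.mem_Ico, funext_iff,
      latticeFloor, Int.floor_eq_iff]
    refine forall_congr' fun i => ?_
    rw [div_le_iff₀' hr, lt_div_iff₀' hr]
  rw [h1, (PiLp.volume_preserving_ofLp (Fin 2)).measure_preimage
    (MeasurableSet.univ_pi fun i => measurableSet_Ico).nullMeasurableSet, volume_pi_pi]
  simp only [Real.volume_Ico]
  rw [Fin.prod_univ_two, ← ENNReal.ofReal_mul (by rw [← sub_div]; simp [hr.le])]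
  congr 1
  field_simp
  ring

lemma norm_sub_latticeFloor_le {r : ℝ} (hr : 0 < r) (x : Plane) :
    ‖x - r⁻¹ • toPlane (latticeFloor r x)‖ ≤ 2 / r := by
  have h1 (i : Fin 2) : (x i - r⁻¹ * ⌊r * x i⌋) ^ 2 ≤ (1 / r) ^ 2 := by
    have h2 : x i - r⁻¹ * ⌊r * x i⌋ = Int.fract (r * x i) / r := by
      rw [Int.fract]; field_simp
    rw [h2]
    gcongr
    · exact (Int.fract_lt_one _).le
  apply le_of_sq_le_sq _ (by positivity)
  rw [EuclideanSpace.norm_sq_eq, Fin.sum_univ_two]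
  simp only [PiLp.sub_apply, PiLp.smul_apply, toPlane, latticeFloor, smul_eq_mul, Real.norm_eq_abs,
    sq_abs]
  refine (add_le_add (h1 0) (h1 1)).trans ?_
  rw [div_pow, div_pow]
  have : 0 < r ^ 2 := by positivity
  rw [← add_div]
  gcongr
  norm_num

section Riemann

variable {F : Plane → ℝ} {B : ℝ}

/-- Rounding moves a point by at most 2, so `1 + ‖·‖` shrinks at most by a factor 3, and `27 = 3³`.
-/
lemma abs_latticeFloor_le (hF : ∀ x, |F x| ≤ B * (1 + ‖x‖) ^ (-3 : ℝ)) {r : ℝ} (hr : 1 ≤ r)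
    (x : Plane) :
    |F (r⁻¹ • toPlane (latticeFloor r x))| ≤ 27 * B * (1 + ‖x‖) ^ (-3 : ℝ) := by
  have hr0 : 0 < r := by linarith
  have hB : 0 ≤ B := by
    have := (abs_nonneg _).trans (hF 0)
    simpa using this
  set y := r⁻¹ • toPlane (latticeFloor r x) with hy
  have h1 : ‖x - y‖ ≤ 2 := (norm_sub_latticeFloor_le hr0 x).trans (div_le_self (by norm_num) hr)
  have h2 : ‖x‖ ≤ ‖x - y‖ + ‖y‖ := by simpa using norm_add_le (x - y) y
  have h3 : (1 + ‖x‖) / 3 ≤ 1 + ‖y‖ := by linarith [norm_nonneg y]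
  have h4 : (1 + ‖y‖) ^ (-3 : ℝ) ≤ ((1 + ‖x‖) / 3) ^ (-3 : ℝ) :=
    Real.rpow_le_rpow_of_nonpos (by positivity) h3 (by norm_num)
  rw [Real.div_rpow (by positivity) (by norm_num)] at h4
  have h5 : (3 : ℝ) ^ (-3 : ℝ) = 1 / 27 := by
    rw [Real.rpow_neg (by norm_num)]; norm_num
  rw [h5] at h4
  calc _ ≤ B * (1 + ‖y‖) ^ (-3 : ℝ) := hF y
    _ ≤ B * ((1 + ‖x‖) ^ (-3 : ℝ) / (1 / 27)) := by gcongr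
    _ = _ := by ring

lemma integrable_rpow_neg_three :
    Integrable (fun x : Plane => (1 + ‖x‖) ^ (-3 : ℝ)) :=
  integrable_one_add_norm (by simp; norm_num)

lemma integrable_latticeFloor (hF : ∀ x, |F x| ≤ B * (1 + ‖x‖) ^ (-3 : ℝ)) {r : ℝ} (hr : 1 ≤ r) :
    Integrable fun x : Plane => F (r⁻¹ • toPlane (latticeFloor r x)) := by
  refine (integrable_rpow_neg_three.const_mul (27 * B)).mono' ?_
    (ae_of_all _ (abs_latticeFloor_le hF hr))
  refine Measurable.aestronglyMeasurable ?_
  exact (measurable_of_countable fun z => F (r⁻¹ • toPlane z)).comp (measurable_latticeFloor r)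

lemma hasSum_riemann (hF : ∀ x, |F x| ≤ B * (1 + ‖x‖) ^ (-3 : ℝ)) {r : ℝ} (hr : 1 ≤ r) :
    HasSum (fun z => (r ^ 2)⁻¹ * F (r⁻¹ • toPlane z))
      (∫ x : Plane, F (r⁻¹ • toPlane (latticeFloor r x))) := by
  have hr0 : 0 < r := by linarith
  set G : Lattice → ℝ := fun z => F (r⁻¹ • toPlane z) with hG
  have hGm : AEStronglyMeasurable G (Measure.map (latticeFloor r) volume) :=
    (measurable_of_countable G).aestronglyMeasurable
  have h1 : Integrable G (Measure.map (latticeFloor r) volume) :=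
    (integrable_map_measure hGm (measurable_latticeFloor r).aemeasurable).2
      (integrable_latticeFloor hF hr)
  have h2 := integral_map (measurable_latticeFloor r).aemeasurable hGm
  rw [← h2, integral_countable h1]
  have h3 (z : Lattice) : (Measure.map (latticeFloor r) volume).real {z} = (r ^ 2)⁻¹ := by
    rw [map_latticeFloor hr0, Measure.real, Measure.smul_apply, Measure.count_singleton,
      smul_eq_mul, mul_one, ENNReal.toReal_ofReal (by positivity)]
  simp only [h3, smul_eq_mul]
  refine Summable.hasSum ?_
  rw [map_latticeFloor hr0] at h1
  have h4 := (integrable_smul_measure (by simp [hr0.ne']) ENNReal.ofReal_ne_top).1 h1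
  exact (integrable_count_iff.1 h4).of_norm.mul_left _

lemma integral_latticeFloor_le (hF : ∀ x, |F x| ≤ B * (1 + ‖x‖) ^ (-3 : ℝ)) {r : ℝ} (hr : 1 ≤ r) :
    ∫ x : Plane, F (r⁻¹ • toPlane (latticeFloor r x))
      ≤ ∫ x : Plane, 27 * B * (1 + ‖x‖) ^ (-3 : ℝ) :=
  integral_mono (integrable_latticeFloor hF hr) (integrable_rpow_neg_three.const_mul _)
    fun x => (le_abs_self _).trans (abs_latticeFloor_le hF hr x)

lemma tendsto_integral_latticeFloor (hFc : Continuous F)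
    (hF : ∀ x, |F x| ≤ B * (1 + ‖x‖) ^ (-3 : ℝ)) :
    Tendsto (fun r : ℝ => ∫ x : Plane, F (r⁻¹ • toPlane (latticeFloor r x))) atTop
      (𝓝 (∫ x, F x)) := by
  refine tendsto_integral_filter_of_dominated_convergence
    (fun x => 27 * B * (1 + ‖x‖) ^ (-3 : ℝ)) ?_ ?_ (integrable_rpow_neg_three.const_mul _) ?_
  · filter_upwards [eventually_ge_atTop 1] with r hr
    exact (integrable_latticeFloor hF hr).aestronglyMeasurable
  · filter_upwards [eventually_ge_atTop 1] with r hr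
    exact ae_of_all _ (abs_latticeFloor_le hF hr)
  · refine ae_of_all _ fun x => (hFc.tendsto x).comp ?_
    rw [tendsto_iff_norm_sub_tendsto_zero]
    refine squeeze_zero' (g := fun r : ℝ => 2 / r) (Eventually.of_forall fun r => norm_nonneg _) ?_
      (tendsto_const_nhds.div_atTop tendsto_id)
    filter_upwards [eventually_gt_atTop 0] with r hr
    rw [norm_sub_rev]
    exact norm_sub_latticeFloor_le hr x

end Riemann

/-- The exponent 3 exceeds the dimension, so both majorants are integrable; the fourth-order
seminorm leaves one power for the factor `‖x‖`. -/
lemma SchwartzMap.exists_norm_mul_le (f : 𝓢(Plane, ℝ)) :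
    ∃ B : ℝ, (∀ x, |f x| ≤ B * (1 + ‖x‖) ^ (-3 : ℝ))
      ∧ ∀ x, |f x * ‖x‖| ≤ B * (1 + ‖x‖) ^ (-3 : ℝ) := by
  refine ⟨2 ^ 4 * (Finset.Iic (4, 0)).sup (fun m => SchwartzMap.seminorm ℝ m.1 m.2) f, ?_⟩
  have h (x : Plane) := SchwartzMap.one_add_le_sup_seminorm_apply (𝕜 := ℝ) (m := (4, 0)) (k := 4)
    (n := 0) le_rfl le_rfl f x
  simp only [norm_iteratedFDeriv_zero, Real.norm_eq_abs] at h
  set B := 2 ^ 4 * (Finset.Iic (4, 0)).sup (fun m => SchwartzMap.seminorm ℝ m.1 m.2) f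
  have h1 (x : Plane) : (1 + ‖x‖) ^ (-3 : ℝ) = ((1 + ‖x‖) ^ 3)⁻¹ := by
    rw [Real.rpow_neg (by positivity)]; norm_cast
  refine ⟨fun x => ?_, fun x => ?_⟩
  · rw [h1, ← div_eq_mul_inv, le_div_iff₀ (by positivity)]
    refine le_trans ?_ (h x)
    rw [mul_comm]
    gcongr
    · linarith [norm_nonneg x]
    · norm_num
  · rw [h1, ← div_eq_mul_inv, le_div_iff₀ (by positivity), abs_mul, abs_norm]
    refine le_trans ?_ (h x)
    calc _ = ‖x‖ * ((1 + ‖x‖) ^ 3 * |f x|) := by ring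
      _ ≤ (1 + ‖x‖) * ((1 + ‖x‖) ^ 3 * |f x|) := by gcongr; linarith
      _ = _ := by ring

/-- The restriction of `f_r` to the lattice. -/
def latticeRescale (f : 𝓢(Plane, ℝ)) (r : ℝ) (z : Lattice) : ℝ := rescale f r (toPlane z)

lemma tendsto_tsum_latticeRescale {f : 𝓢(Plane, ℝ)} (hf : ∫ x, f x = 1) :
    Tendsto (fun r => ∑' z, latticeRescale f r z) atTop (𝓝 1) := by
  obtain ⟨B, hB, -⟩ := SchwartzMap.exists_norm_mul_le f
  rw [← hf]
  refine (tendsto_integral_latticeFloor f.continuous hB).congr' ?_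
  filter_upwards [eventually_ge_atTop 1] with r hr
  exact (hasSum_riemann hB hr).tsum_eq.symm

lemma summable_latticeRescale (f : 𝓢(Plane, ℝ)) {r : ℝ} (hr : 1 ≤ r) :
    Summable (latticeRescale f r) := by
  obtain ⟨B, hB, -⟩ := SchwartzMap.exists_norm_mul_le f
  exact (hasSum_riemann hB hr).summable

/-- The first moment of `f_r` on the lattice is `r` times a Riemann sum of `f(x)‖x‖`. This linear
growth makes `β` of order `ε √t`. -/
lemma exists_tsum_latticeRescale_mul_norm_le (f : 𝓢(Plane, ℝ)) :
    ∃ M : ℝ, 0 ≤ M ∧ ∀ r : ℝ, 1 ≤ r → Summable (fun z => latticeRescale f r z * ‖toPlane z‖)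
      ∧ ∑' z, latticeRescale f r z * ‖toPlane z‖ ≤ M * r := by
  obtain ⟨B, -, hB⟩ := SchwartzMap.exists_norm_mul_le f
  have hB0 : 0 ≤ B := by
    have := (abs_nonneg _).trans (hB 0)
    simpa using this
  refine ⟨∫ x : Plane, 27 * B * (1 + ‖x‖) ^ (-3 : ℝ),
    integral_nonneg fun x => by positivity, fun r hr => ?_⟩
  have hr0 : 0 < r := by linarith
  have h := (hasSum_riemann hB hr).mul_right r
  have h1 (z : Lattice) : (r ^ 2)⁻¹ * (f (r⁻¹ • toPlane z) * ‖r⁻¹ • toPlane z‖) * r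
      = latticeRescale f r z * ‖toPlane z‖ := by
    rw [latticeRescale, rescale, norm_smul, norm_inv, Real.norm_of_nonneg hr0.le]
    field_simp
  simp only [h1] at h
  refine ⟨h.summable, ?_⟩
  rw [h.tsum_eq]
  exact mul_le_mul_of_nonneg_right (integral_latticeFloor_le hB hr) hr0.le

end Rescale

/-! ### The difference of the counts as a torus integral, and its exponential moment -/

section Difference

lemma toPlane_sub (x z : Lattice) : toPlane (x - z) = toPlane x - toPlane z := by
  ext i; simp [toPlane]

variable {f : 𝓢(Plane, ℝ)}

lemma latticeConv_rescale (r : ℝ) (x : Lattice) :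
    latticeConv (rescale f r) (toPlane x)
      = ∑' z, latticeRescale f r z * latticeRescale f r (x - z) := by
  simp only [latticeConv, latticeRescale, toPlane_sub]

lemma latticeRescale_nonneg (hf : ∀ x, 0 ≤ f x) (r : ℝ) (z : Lattice) :
    0 ≤ latticeRescale f r z :=
  mul_nonneg (by positivity) (hf _)

lemma integral_one_sub_latticeFourier_sq_mul_character (hf : ∀ x, 0 ≤ f x) {r : ℝ} (hr : 1 ≤ r)
    (x : Lattice) :
    ∫ p, (1 - latticeFourier (latticeRescale f r) p ^ 2) * character x p
      = (((if x = 0 then 1 else 0) - latticeConv (rescale f r) (toPlane x) : ℝ) : ℂ) := by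
  have hg := summable_latticeRescale f hr
  have hc := continuous_latticeFourier hg
  have hb (p : Torus) := norm_latticeFourier_le hg (latticeRescale_nonneg hf r) p
  simp only [sub_mul, one_mul]
  rw [integral_sub, integral_character,
    integral_latticeFourier_sq_mul_character hg (latticeRescale_nonneg hf r), latticeConv_rescale]
  · push_cast
    split_ifs <;> simp
  · exact Integrable.of_bound (continuous_character x).aestronglyMeasurable 1
      (ae_of_all _ fun p => (norm_character x p).le)
  · refine Integrable.of_bound ((hc.pow 2).mul (continuous_character x)).aestronglyMeasurable
      ((∑' z, latticeRescale f r z) ^ 2) (ae_of_all _ fun p => ?_)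
    rw [norm_mul, norm_pow, norm_character, mul_one]
    gcongr
    exact hb p

/-- The ratio of the Fourier transform of `δ₀ - f_r ⊛ f_r`, shifted by `y`, to the density of
`kernelMeasure α β`. -/
def kernelRatio (f : 𝓢(Plane, ℝ)) (r α β : ℝ) (y : Lattice) (p : Torus) : ℂ :=
  (1 - latticeFourier (latticeRescale f r) p ^ 2) * character y p / (kernelWeight α β p : ℂ)

lemma measurable_kernelRatio {r : ℝ} (hr : 1 ≤ r) (α β : ℝ) (y : Lattice) :
    Measurable (kernelRatio f r α β y) := by
  have h1 := (continuous_latticeFourier (summable_latticeRescale f hr)).measurable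
  have h2 := (continuous_character y).measurable
  have h3 := (continuous_kernelWeight α β).measurable
  unfold kernelRatio
  fun_prop

lemma norm_kernelRatio_le {r α β : ℝ}
    (h : ∀ p, ‖1 - latticeFourier (latticeRescale f r) p ^ 2‖ ≤ kernelWeight α β p)
    (y : Lattice) (p : Torus) : ‖kernelRatio f r α β y p‖ ≤ 1 := by
  rw [kernelRatio, norm_div, norm_mul, norm_character, mul_one, Complex.norm_real,
    Real.norm_of_nonneg ((norm_nonneg _).trans (h p))]
  exact div_le_one_of_le₀ (h p) ((norm_nonneg _).trans (h p))

lemma crossIntegral_kernelRatio (hf : ∀ x, 0 ≤ f x) {r α β : ℝ} (hr : 1 ≤ r)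
    (h : ∀ p, ‖1 - latticeFourier (latticeRescale f r) p ^ 2‖ ≤ kernelWeight α β p)
    {Ω : Type*} (S₁ S₂ : ℕ → Ω → Lattice) (n : ℕ) (y : Lattice) (ω : Ω) :
    crossIntegral (kernelMeasure α β) (kernelRatio f r α β y) (fun k => S₁ k ω) (fun k => S₂ k ω) n
      = ((intersectionCount S₁ S₂ n y ω - smoothedCount S₁ S₂ f r n y ω : ℝ) : ℂ) := by
  have hc := continuous_latticeFourier (summable_latticeRescale f hr)
  have h1 (p : Torus) : (ENNReal.ofReal (kernelWeight α β p)).toReal •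
      (kernelRatio f r α β y p * (occupationTransform (fun k => S₂ k ω) n p
        * (starRingEnd ℂ) (occupationTransform (fun k => S₁ k ω) n p)))
      = ∑ n₁ ∈ Finset.Icc 1 n, ∑ n₂ ∈ Finset.Icc 1 n,
        (1 - latticeFourier (latticeRescale f r) p ^ 2)
          * character (S₂ n₂ ω - S₁ n₁ ω + y) p := by
    have hk : 0 ≤ kernelWeight α β p := (norm_nonneg _).trans (h p)
    have h2 : (kernelWeight α β p : ℂ) * kernelRatio f r α β y p
        = (1 - latticeFourier (latticeRescale f r) p ^ 2) * character y p := by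
      -- Where the density vanishes so does the numerator, so division by zero does no harm.
      rcases hk.eq_or_lt with h0 | h0
      · have h3 := h p
        rw [← h0, norm_le_zero_iff] at h3
        rw [kernelRatio, h3]; simp
      · rw [kernelRatio, mul_div_cancel₀]
        exact_mod_cast h0.ne'
    rw [ENNReal.toReal_ofReal hk, Complex.real_smul, ← mul_assoc, h2]
    simp only [occupationTransform, map_sum]
    rw [mul_comm (∑ n ∈ Finset.Icc 1 n, _), Finset.sum_mul_sum, Finset.mul_sum]
    refine Finset.sum_congr rfl fun n₁ _ => ?_
    rw [Finset.mul_sum]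
    refine Finset.sum_congr rfl fun n₂ _ => ?_
    rw [← character_neg_left, sub_eq_add_neg (S₂ n₂ ω) (S₁ n₁ ω), character_add_left, character_add_left]
    ring
  have hi (x : Lattice) : Integrable fun p =>
      (1 - latticeFourier (latticeRescale f r) p ^ 2) * character x p := by
    refine Integrable.of_bound (((continuous_const.sub (hc.pow 2)).mul
      (continuous_character x)).aestronglyMeasurable) 5 (ae_of_all _ fun p => ?_)
    rw [norm_mul, norm_character, mul_one]
    exact (h p).trans (min_le_left _ _)
  rw [crossIntegral, kernelMeasure, integral_withDensity_eq_integral_toReal_smul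
    (measurable_ofReal_kernelWeight α β) (ae_of_all _ fun p => ENNReal.ofReal_lt_top)]
  simp_rw [h1]
  rw [integral_finsetSum _ fun n₁ _ => integrable_finsetSum _ fun n₂ _ => hi _]
  simp_rw [integral_finsetSum _ fun n₂ _ => hi _,
    integral_one_sub_latticeFourier_sq_mul_character hf hr]
  rw [intersectionCount, smoothedCount, ← Finset.sum_sub_distrib]
  simp_rw [← Finset.sum_sub_distrib]
  push_cast
  refine Finset.sum_congr rfl fun n₁ _ => Finset.sum_congr rfl fun n₂ _ => ?_
  congr 2
  have : S₂ n₂ ω - S₁ n₁ ω + y = 0 ↔ S₁ n₁ ω = S₂ n₂ ω + y := by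
    rw [sub_add_eq_add_sub, sub_eq_zero, eq_comm]
  simp only [this]

/-- The bound `e^x ≤ 2 cosh x` leaves even powers only, which removes the square root. -/
lemma ofReal_exp_mul_sqrt_le {lam t : ℝ} (ht : 0 < t) (z : ℝ) :
    ENNReal.ofReal (Real.exp (lam * √|z / t|))
      ≤ 2 * ∑' m : ℕ, ENNReal.ofReal ((lam ^ 2 / t) ^ m / (2 * m).factorial) * ‖z‖ₑ ^ m := by
  set x := lam * √|z / t| with hx
  have h1 : Real.exp x ≤ 2 * Real.cosh x := by
    rw [Real.cosh_eq]; linarith [Real.exp_pos (-x)]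
  have h2 (m : ℕ) : x ^ (2 * m) / (2 * m).factorial
      = (lam ^ 2 / t) ^ m / (2 * m).factorial * |z| ^ m := by
    rw [pow_mul, hx, mul_pow, Real.sq_sqrt (abs_nonneg _), abs_div, abs_of_pos ht,
      show lam ^ 2 * (|z| / t) = lam ^ 2 / t * |z| by ring, mul_pow]
    ring
  have h3 := Real.hasSum_cosh x
  simp_rw [h2] at h3
  calc _ ≤ ENNReal.ofReal (2 * Real.cosh x) := ENNReal.ofReal_le_ofReal h1
    _ = 2 * ENNReal.ofReal (Real.cosh x) := by
        rw [ENNReal.ofReal_mul (by norm_num), ENNReal.ofReal_ofNat]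
    _ = _ := by
        rw [← h3.tsum_eq, ENNReal.ofReal_tsum_of_nonneg (fun m => by positivity) h3.summable]
        congr 1
        refine tsum_congr fun m => ?_
        rw [ENNReal.ofReal_mul (by positivity), ENNReal.ofReal_pow (abs_nonneg _),
          ← Real.norm_eq_abs, ofReal_norm]

/-- By Cauchy–Schwarz `E |Z|^m ≤ T (2m)`, so only even terms of the series occur. Doubling `λ`
leaves a factor `4^{-m}`, each term is then bounded by the whole series, and `8/3 = 2 ∑ 4^{-m}`. -/
lemma lintegral_exp_mul_sqrt_le {Ω : Type*} [MeasurableSpace Ω] {P : Measure Ω}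
    [IsProbabilityMeasure P] {Z : Ω → ℝ} (hZ : AEMeasurable Z P) {T : ℕ → ℝ≥0∞}
    (hT : ∀ m, ∫⁻ ω, ‖Z ω‖ₑ ^ (2 * m) ∂P ≤ T (2 * m) ^ 2) {lam t : ℝ} (hlam : 0 < lam)
    (ht : 0 < t) :
    ∫⁻ ω, ENNReal.ofReal (Real.exp (lam * √|Z ω / t|)) ∂P
      ≤ ENNReal.ofReal (8 / 3)
        * ∑' m : ℕ, ENNReal.ofReal (2 * lam / √t) ^ m * (m.factorial : ℝ≥0∞)⁻¹ * T m := by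
  set S := ∑' m : ℕ, ENNReal.ofReal (2 * lam / √t) ^ m * (m.factorial : ℝ≥0∞)⁻¹ * T m with hS
  have h1 (m : ℕ) : ∫⁻ ω, ‖Z ω‖ₑ ^ m ∂P ≤ T (2 * m) := by
    rw [← ENNReal.pow_le_pow_left_iff two_ne_zero]
    refine le_trans ?_ (hT m)
    have := sq_lintegral_mul_le (m := P) (hZ.enorm.pow_const m) (aemeasurable_const (b := 1))
    simpa [← pow_mul, mul_comm m 2] using this
  have h2 (m : ℕ) : ENNReal.ofReal ((lam ^ 2 / t) ^ m / (2 * m).factorial) * T (2 * m)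
      ≤ ENNReal.ofReal ((1 / 4) ^ m) * S := by
    have hfac : (0 : ℝ) < (2 * m).factorial := by exact_mod_cast Nat.factorial_pos _
    have h3 : ENNReal.ofReal ((lam ^ 2 / t) ^ m / (2 * m).factorial)
        = ENNReal.ofReal ((1 / 4) ^ m)
          * (ENNReal.ofReal (2 * lam / √t) ^ (2 * m) * ((2 * m).factorial : ℝ≥0∞)⁻¹) := by
      rw [← ENNReal.ofReal_natCast, ← ENNReal.ofReal_inv_of_pos hfac,
        ← ENNReal.ofReal_pow (by positivity), ← ENNReal.ofReal_mul (by positivity),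
        ← ENNReal.ofReal_mul (by positivity), pow_mul, div_pow (2 * lam), Real.sq_sqrt ht.le]
      congr 1
      rw [← mul_assoc, ← mul_pow, ← div_eq_mul_inv]
      congr 2
      ring
    rw [h3, mul_assoc]
    gcongr
    exact ENNReal.le_tsum (f := fun m : ℕ =>
      ENNReal.ofReal (2 * lam / √t) ^ m * (m.factorial : ℝ≥0∞)⁻¹ * T m) (2 * m)
  calc _ ≤ ∫⁻ ω, 2 * ∑' m : ℕ, ENNReal.ofReal ((lam ^ 2 / t) ^ m / (2 * m).factorial)
          * ‖Z ω‖ₑ ^ m ∂P := lintegral_mono fun ω => ofReal_exp_mul_sqrt_le ht (Z ω)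
    _ = 2 * ∑' m : ℕ, ENNReal.ofReal ((lam ^ 2 / t) ^ m / (2 * m).factorial)
          * ∫⁻ ω, ‖Z ω‖ₑ ^ m ∂P := by
        rw [lintegral_const_mul' _ _ (by simp), lintegral_tsum fun m => by fun_prop]
        simp_rw [lintegral_const_mul' _ _ ENNReal.ofReal_ne_top]
    _ ≤ 2 * ∑' m : ℕ, ENNReal.ofReal ((1 / 4) ^ m) * S := by
        exact mul_le_mul' le_rfl
          (ENNReal.tsum_le_tsum fun m => (mul_le_mul' le_rfl (h1 m)).trans (h2 m))
    _ = _ := by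
        rw [ENNReal.tsum_mul_right, ← ENNReal.ofReal_tsum_of_nonneg (fun m => by positivity)
          (summable_geometric_of_lt_one (by norm_num) (by norm_num)),
          tsum_geometric_of_lt_one (by norm_num) (by norm_num), ← mul_assoc]
        congr 1
        rw [← ENNReal.ofReal_ofNat 2, ← ENNReal.ofReal_mul (by norm_num)]
        norm_num

end Difference

/-! ### Block decomposition and choice of the parameters -/

section Limit

variable {Ω : Type*} [MeasurableSpace Ω] {P : Measure Ω} [IsProbabilityMeasure P]
  {ν : Measure Lattice} {X : Fin 2 → ℕ → Ω → Lattice} {f : 𝓢(Plane, ℝ)}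

lemma lintegral_exp_sqrt_intersectionCount_sub_le (hlaw : ∀ i k, HasLaw (X i k) ν P)
    (hindep : iIndepFun (fun q : Fin 2 × ℕ => X q.1 q.2) P) (hf : ∀ x, 0 ≤ f x) {r α β : ℝ}
    (hr : 1 ≤ r) (h : ∀ p, ‖1 - latticeFourier (latticeRescale f r) p ^ 2‖ ≤ kernelWeight α β p)
    {lam t : ℝ} (hlam : 0 < lam) (ht : 0 < t) (n : ℕ) (y : Lattice) :
    ∫⁻ ω, ENNReal.ofReal (Real.exp (lam * √|(intersectionCount (walk (X 0)) (walk (X 1)) n y ω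
        - smoothedCount (walk (X 0)) (walk (X 1)) f r n y ω) / t|)) ∂P
      ≤ ENNReal.ofReal (8 / 3)
        * transformGenFun ν (kernelMeasure α β) (ENNReal.ofReal (2 * lam / √t)) n := by
  have hw := measurable_kernelRatio (f := f) hr α β y
  have h1 := crossIntegral_kernelRatio hf hr h (walk (X 0)) (walk (X 1)) n y
  have hm := (aestronglyMeasurable_crossIntegral (μ := kernelMeasure α β) hlaw hw n).aemeasurable.re
  simp_rw [h1] at hm
  refine lintegral_exp_mul_sqrt_le (by simpa using hm) (fun m => ?_) hlam ht
  have h2 := lintegral_pow_crossIntegral_le (μ := kernelMeasure α β) hlaw hindep hw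
    (norm_kernelRatio_le h y) n m (fun ω => by rw [h1, Complex.conj_ofReal])
  simp_rw [h1] at h2
  refine le_trans (le_of_eq ?_) (h2.trans ?_)
  · refine lintegral_congr fun ω => ?_
    rw [← ofReal_norm, ← ofReal_norm, Complex.norm_real]
  · gcongr
    exact le_iSup (fun q => eLpNorm (fun p : Fin (2 * m) → Torus => walkTransform ν n q p) 2
      (Measure.pi fun _ => kernelMeasure α β)) 0

/-- The bound for fixed parameters, obtained by cutting the walks into blocks of `⌊t / k⌋`
steps. -/
lemma transformGenFun_kernelMeasure_le_exp [IsProbabilityMeasure ν]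
    (hlaw : ∀ i k, HasLaw (X i k) ν P)
    (hindep : iIndepFun (fun q : Fin 2 × ℕ => X q.1 q.2) P) {C C' α B η lam t b : ℝ} {k n : ℕ}
    (hC1 : 1 ≤ C) (hα : 0 ≤ α) (hB : 0 ≤ B) (hη : 0 ≤ η) (hlam : 0 < lam) (hC'0 : 0 ≤ C')
    (hC : ∀ N : ℕ, 1 ≤ N → ∫ p, greenBound ν N p ^ 2 ≤ C * N)
    (hC' : ∀ N : ℕ, 1 ≤ N → ∫ p, torusDist p * greenBound ν N p ^ 2 ≤ C' * √N)
    (hk : 1 ≤ k) (hkC : 320 * lam ^ 2 * C ≤ k) (hkt : k ≤ t) (hnt : (n : ℝ) = b * t) (hb : 0 ≤ b)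
    (hsmall : 20 * C * (α * C + B * √(2 * k) * C') ≤ η ^ 4) :
    transformGenFun ν (kernelMeasure α (B * √t)) (ENNReal.ofReal (2 * lam / √t)) n
      ≤ ENNReal.ofReal (Real.exp (η * (2 * k * b + 1))) := by
  have hk0 : (0 : ℝ) < k := by exact_mod_cast hk
  have ht : 0 < t := hk0.trans_le hkt
  set N := ⌊t / k⌋₊ with hN
  have hN1 : 1 ≤ N := by
    rw [hN, Nat.one_le_floor_iff]; exact (one_le_div hk0).2 hkt
  have hN1' : (1 : ℝ) ≤ N := by exact_mod_cast hN1
  have hNle : k * (N : ℝ) ≤ t := by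
    have := Nat.floor_le (a := t / k) (by positivity)
    rw [← hN, le_div_iff₀ hk0] at this; linarith
  have hNge : t ≤ 2 * k * N := by
    have := Nat.lt_floor_add_one (t / k)
    rw [← hN, div_lt_iff₀ hk0] at this
    nlinarith
  have hsq : √t ≤ √(2 * k) * √N := by
    rw [← Real.sqrt_mul (by positivity)]; exact Real.sqrt_le_sqrt hNge
  have hNN : √(N : ℝ) * √N = N := Real.mul_self_sqrt (by positivity)
  have key : ∀ N' ≤ N, transformGenFun ν (kernelMeasure α (B * √t))
      (ENNReal.ofReal (2 * lam / √t)) N' ≤ ENNReal.ofReal (1 + η) := by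
    intro N' hN'
    refine transformGenFun_kernelMeasure_le hlaw hindep hC1 hα (by positivity) hη (by positivity)
      (hC N hN1) (hC' N hN1) ?_ ?_ hN'
    · have h1 : B * √t * (C' * √N) ≤ B * √(2 * k) * C' * N := by
        calc _ ≤ B * (√(2 * k) * √N) * (C' * √N) := by gcongr
          _ = B * √(2 * k) * C' * (√N * √N) := by ring
          _ = _ := by rw [hNN]
      calc _ ≤ 20 * C * N * (α * (C * N) + B * √(2 * k) * C' * N) := by gcongr
        _ = 20 * C * (α * C + B * √(2 * k) * C') * (N : ℝ) ^ 2 := by ring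
        _ ≤ η ^ 4 * (N : ℝ) ^ 2 := by gcongr
        _ = _ := by ring
    · rw [div_mul_eq_mul_div, div_le_iff₀ (Real.sqrt_pos.2 ht)]
      -- The origin of 320: `2λ √(20CN) ≤ √t / 2` means `320 λ² C N ≤ t`, and `k N ≤ t`.
      have h1 : √(20 * C * N) ≤ √t / (4 * lam) := by
        rw [Real.sqrt_le_left (by positivity), div_pow, Real.sq_sqrt ht.le,
          le_div_iff₀ (by positivity)]
        calc _ = 320 * lam ^ 2 * C * N := by ring
          _ ≤ k * N := by gcongr
          _ ≤ t := hNle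
      calc _ ≤ 2 * lam * (√t / (4 * lam)) := by gcongr
        _ = _ := by field_simp; norm_num
  have hn : n ≤ (n / N + 1) * N := by
    have := Nat.div_add_mod n N
    have := Nat.mod_lt n (by omega : N > 0)
    rw [add_mul, one_mul, mul_comm]; omega
  have hdiv : ((n / N + 1 : ℕ) : ℝ) ≤ 2 * k * b + 1 := by
    push_cast
    gcongr
    refine Nat.cast_div_le.trans ?_
    rw [div_le_iff₀ (by positivity), hnt]
    calc _ ≤ b * (2 * k * N) := by gcongr
      _ = _ := by ring
  refine (transformGenFun_le_pow ν _ (ENNReal.one_le_ofReal.2 (by linarith)) key _ n hn).trans ?_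
  rw [← ENNReal.ofReal_pow (by positivity)]
  refine ENNReal.ofReal_le_ofReal ?_
  calc (1 + η) ^ (n / N + 1) ≤ Real.exp η ^ (n / N + 1) := by
        gcongr; linarith [Real.add_one_le_exp η]
    _ = Real.exp (η * (n / N + 1 : ℕ)) := by rw [← Real.exp_nat_mul, mul_comm]
    _ ≤ _ := by gcongr

lemma tendsto_div_atTop_of_isLittleO {b : ℕ → ℝ} (hbtop : Tendsto b atTop atTop)
    (hbo : b =o[atTop] (fun n : ℕ => (n : ℝ))) :
    Tendsto (fun n : ℕ => (n : ℝ) / b n) atTop atTop := by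
  have h1 : Tendsto (fun n : ℕ => b n / n) atTop (𝓝[>] 0) := by
    refine tendsto_nhdsWithin_iff.2 ⟨hbo.tendsto_div_nhds_zero, ?_⟩
    filter_upwards [hbtop.eventually_gt_atTop 0, eventually_gt_atTop 0] with n h2 h3
    have : (0 : ℝ) < n := by exact_mod_cast h3
    exact div_pos h2 this
  exact h1.inv_tendsto_nhdsGT_zero.congr fun n => by simp

theorem eventually_lintegral_exp_sqrt_intersectionCount_sub_le [IsProbabilityMeasure ν]
    (hν : IsAdmissibleStep ν)
    (hlaw : ∀ i k, HasLaw (X i k) ν P)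
    (hindep : iIndepFun (fun q : Fin 2 × ℕ => X q.1 q.2) P) {b : ℕ → ℝ}
    (hbtop : Tendsto b atTop atTop) (hbo : b =o[atTop] (fun n : ℕ => (n : ℝ)))
    (hf : ∀ x, 0 ≤ f x) (hf1 : ∫ x, f x = 1) {lam δ : ℝ} (hlam : 0 < lam) (hδ : 0 < δ) :
    ∀ᶠ ε in 𝓝[>] (0 : ℝ), ∀ᶠ n : ℕ in atTop, ∀ y,
      ∫⁻ ω, ENNReal.ofReal (Real.exp (lam * √|(intersectionCount (walk (X 0)) (walk (X 1)) n y ω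
        - smoothedCount (walk (X 0)) (walk (X 1)) f (√((n : ℝ) / b n) * ε) n y ω)
          / ((n : ℝ) / b n)|)) ∂P ≤ ENNReal.ofReal (Real.exp (δ * b n)) := by
  obtain ⟨C₀, -, hC₀⟩ := hν.exists_integral_greenBound_sq_le
  obtain ⟨C', hC'0, hC'⟩ := hν.exists_integral_torusDist_mul_greenBound_sq_le
  obtain ⟨M, hM0, hM⟩ := exists_tsum_latticeRescale_mul_norm_le f
  set C := max C₀ 1
  have hC (N : ℕ) (hN : 1 ≤ N) : ∫ p, greenBound ν N p ^ 2 ≤ C * N :=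
    (hC₀ N hN).trans (by gcongr; exact le_max_left _ _)
  obtain ⟨k, hk⟩ := exists_nat_ge (max 1 (320 * lam ^ 2 * C))
  have hk1 : 1 ≤ k := by exact_mod_cast (le_max_left _ _).trans hk
  have hk0 : (0 : ℝ) < k := by exact_mod_cast hk1
  -- At most `2 k b_n + 1` blocks cost `η` each, so their main cost is `δ b_n / 2`; the other half
  -- absorbs `η` and the factor `8/3 ≤ e` for large `n`.
  set η := δ / (4 * k) with hη
  have hη0 : 0 < η := by positivity
  -- The block smallness condition without `α`, strict so that it persists for large `n`, as `α`
  -- tends to zero for fixed `ε`.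
  have hε : ∀ᶠ ε in 𝓝[>] (0 : ℝ), 20 * C * (6 * Real.pi * M * ε * √(2 * k) * C') < η ^ 4 := by
    have : Tendsto (fun ε : ℝ => 20 * C * (6 * Real.pi * M * ε * √(2 * k) * C')) (𝓝[>] 0)
        (𝓝 (20 * C * (6 * Real.pi * M * 0 * √(2 * k) * C'))) :=
      Continuous.tendsto (by fun_prop) 0 |>.mono_left nhdsWithin_le_nhds
    refine this.eventually_lt_const ?_
    simpa using by positivity
  filter_upwards [hε, self_mem_nhdsWithin] with ε hε hε0
  have hε0 : 0 < ε := hε0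
  have htt := tendsto_div_atTop_of_isLittleO hbtop hbo
  have hr : Tendsto (fun n : ℕ => √((n : ℝ) / b n) * ε) atTop atTop :=
    (Real.tendsto_sqrt_atTop.comp htt).atTop_mul_const hε0
  have hs := (tendsto_tsum_latticeRescale hf1).comp hr
  have hα : Tendsto (fun n : ℕ => 20 * C * (3 * |1 - ∑' z, latticeRescale f
      (√((n : ℝ) / b n) * ε) z| * C + 6 * Real.pi * M * ε * √(2 * k) * C')) atTop
      (𝓝 (20 * C * (3 * |1 - 1| * C + 6 * Real.pi * M * ε * √(2 * k) * C'))) :=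
    ((((hs.const_sub 1).abs.const_mul 3).mul_const C).add_const _).const_mul _
  filter_upwards [htt.eventually_ge_atTop (k : ℝ), hr.eventually_ge_atTop 1,
    hs.eventually_le_const one_lt_two, hα.eventually_lt_const (u := η ^ 4) (by simpa using hε),
    hbtop.eventually_ge_atTop (2 * (1 + η) / δ), hbtop.eventually_gt_atTop 0]
    with n hkt hr1 hs2 hsmall hb hb0 y
  simp only [Function.comp_apply] at hs2
  set t := (n : ℝ) / b n with ht
  have ht0 : 0 < t := hk0.trans_le hkt
  have hker (p : Torus) : ‖1 - latticeFourier (latticeRescale f (√t * ε)) p ^ 2‖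
      ≤ kernelWeight (3 * |1 - ∑' z, latticeRescale f (√t * ε) z|) (6 * Real.pi * M * ε * √t) p := by
    refine (norm_one_sub_latticeFourier_sq_le (summable_latticeRescale f hr1)
      (latticeRescale_nonneg hf _) hs2 (hM _ hr1).1 p).trans ?_
    refine min_le_min le_rfl (add_le_add le_rfl (mul_le_mul_of_nonneg_right ?_ ?_))
    · calc _ ≤ 6 * Real.pi * (M * (√t * ε)) := by
            gcongr
            exact (hM _ hr1).2
        _ = _ := by ring
    · exact torusDist_nonneg p
  refine (lintegral_exp_sqrt_intersectionCount_sub_le hlaw hindep hf hr1 hker hlam ht0 n y).trans ?_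
  refine (mul_le_mul' le_rfl (transformGenFun_kernelMeasure_le_exp hlaw hindep (b := b n) (η := η)
    (le_max_right _ _) (by positivity) (by positivity) hη0.le hlam hC'0.le hC hC' hk1
    ((le_max_right _ _).trans hk) hkt (by rw [ht]; field_simp) hb0.le hsmall.le)).trans ?_
  rw [← ENNReal.ofReal_mul (by norm_num)]
  refine ENNReal.ofReal_le_ofReal ?_
  have h83 : (8 / 3 : ℝ) ≤ Real.exp 1 := by linarith [Real.exp_one_gt_d9]
  calc _ ≤ Real.exp 1 * Real.exp (η * (2 * k * b n + 1)) := by gcongr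
    _ = Real.exp (1 + η * (2 * k * b n + 1)) := by rw [Real.exp_add]
    _ ≤ _ := by
      rw [Real.exp_le_exp]
      have h1 : η * (2 * k * b n) = δ * b n / 2 := by rw [hη]; field_simp; norm_num
      rw [div_le_iff₀ hδ] at hb
      linarith

end Limit

end PlanarWalk

end

/-! ### Conclusion in the extended reals -/

theorem theorem4p1 {Ω : Type*} [MeasurableSpace Ω] (P : Measure Ω) [IsProbabilityMeasure P]
    (ν : Measure PlanarWalk.Lattice) [IsProbabilityMeasure ν]
    (hν : PlanarWalk.IsAdmissibleStep ν)
    (X : Fin 2 → ℕ → Ω → PlanarWalk.Lattice)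
    (hlaw : ∀ i k, HasLaw (X i k) ν P)
    (hindep : iIndepFun (fun q : Fin 2 × ℕ => X q.1 q.2) P)
    (b : ℕ → ℝ) (hbpos : ∀ n, 1 ≤ n → 0 < b n) (hbtop : Tendsto b atTop atTop)
    (hbo : b =o[atTop] (fun n : ℕ => (n : ℝ)))
    (f : 𝓢(PlanarWalk.Plane, ℝ)) (hf : PlanarWalk.IsBandLimitedDensity f)
    (lam : ℝ) (hlam : 0 < lam) :
    limsup (fun ε : ℝ => limsup (fun n : ℕ => ⨆ y : PlanarWalk.Lattice,
      ENNReal.log (∫⁻ ω, ENNReal.ofReal (Real.exp (lam * Real.sqrt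
        |(PlanarWalk.intersectionCount (PlanarWalk.walk (X 0)) (PlanarWalk.walk (X 1)) n y ω
          - PlanarWalk.smoothedCount (PlanarWalk.walk (X 0)) (PlanarWalk.walk (X 1)) f
              (Real.sqrt ((n : ℝ) / b n) * ε) n y ω) / ((n : ℝ) / b n)|)) ∂P)
        / ((b n : ℝ) : EReal)) atTop) (𝓝[>] (0 : ℝ)) = 0 := by
  refine le_antisymm (EReal.le_of_forall_lt_iff_le.1 fun δ hδ => ?_) ?_
  · have hδ : 0 < δ := by exact_mod_cast hδ
    refine limsup_le_of_le (by isBoundedDefault) ?_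
    filter_upwards [PlanarWalk.eventually_lintegral_exp_sqrt_intersectionCount_sub_le hν hlaw hindep
      hbtop hbo hf.nonneg hf.integral_eq_one hlam hδ] with ε hε
    refine limsup_le_of_le (by isBoundedDefault) ?_
    filter_upwards [hε, eventually_ge_atTop 1] with n hn hn1
    refine iSup_le fun y => ?_
    rw [EReal.div_le_iff_le_mul (by exact_mod_cast hbpos n hn1) (EReal.coe_ne_top _)]
    refine (ENNReal.log_le_log (hn y)).trans ?_
    rw [ENNReal.log_ofReal_of_pos (Real.exp_pos _), Real.log_exp, mul_comm, EReal.coe_mul]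
  -- The integrand is at least 1, so every logarithm is nonnegative; one value of `y` bounds the
  -- supremum from below.
  · refine le_limsup_of_frequently_le' (Eventually.frequently (Eventually.of_forall fun ε => ?_))
    refine le_limsup_of_frequently_le' (Eventually.frequently ?_)
    filter_upwards [eventually_ge_atTop 1] with n hn1
    refine le_iSup_of_le 0 (EReal.div_nonneg ?_ (by exact_mod_cast (hbpos n hn1).le))
    rw [ENNReal.zero_le_log_iff]
    calc (1 : ℝ≥0∞) = ∫⁻ _, 1 ∂P := by simp
      _ ≤ _ := lintegral_mono fun ω => ENNReal.one_le_ofReal.2 (Real.one_le_exp (by positivity))
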